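/- Let $V$ be a finite set, $K$ a set of colours, $c^{(0)}:V\to K$ an initial colouring and $d\ge 1$ an integer. Graphs are labelled graphs on $V$ without self-loops or multiple edges, either all undirected or all directed; an undirected edge $uv$ is also regarded as the two pairs $(u,v),(v,u)$. The colour refinement (CR) colours of a graph $G$ are $$c_G^{(t+1)}(v)=\operatorname{hash}\bigl(c_G^{(t)}(v),\{\!\{c_G^{(t)}(x): x\in N(v)\}\!\}\bigr)$$ for undirected $G$ and $$c_G^{(t+1)}(v)=\operatorname{hash}\bigl(c_G^{(t)}(v),\{\!\{c_G^{(t)}(x): x\in N_{\rm in}(v)\}\!\},\{\!\{c_G^{(t)}(x): x\in N_{\rm out}(v)\}\!\}\bigr)$$ for directed $G$, with $c_G^{(0)}=c^{(0)}$ and an arbitrary fixed injective $K$-valued function $\operatorname{hash}$. Let $\mathcal N^d_G(c^{(0)})$ be the set of all graphs $H$ on $V$ (of the same kind, undirected or directed, as $G$) with $c_H^{(d)}=c_G^{(d)}$. Fix $G$ and put $c=c_G^{(d-1)}$, with colour classes $C_i=c^{-1}(i)$. For colours $i,j$ let $g_{ij}$ be the subgraph with nodes $C_i\cup C_j$ and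 edges $E(g_{ij})=\{(x,y): x\in C_i,\ y\in C_j,\ xy\in E\}$, where $E$ is the edge set of the current graph. Let $\mathcal G$ be the list of those $g_{ij}$ that are non-empty in $G$, in any order; for undirected graphs $g_{ij}$ and $g_{ji}$ are the same subgraph and only one of them, with either orientation, is listed. One *step* on $g_{ij}$ is the following. 1. Draw $(u_1,v_1)$ and $(u_2,v_2)$ independently and uniformly from $E(g_{ij})$. If $u_1,v_1,u_2,v_2$ are four distinct nodes and $u_1v_2,u_2v_1\notin E(g_{ij})$, replace the edges $u_1v_1,u_2v_2$ by $u_1v_2,u_2v_1$. 2. If the graph is directed and $i=j$, then draw nodes $w_1,w_2,w_3$ independently and uniformly from $C_i$. If the edges among them are exactly $w_1w_2,w_2w_3,w_3w_1$, reverse these three edges. *Algorithm 1* with parameter $r\in\mathbb N$ starts from $G$, visits the members $g$ of $\mathcal G$ one after the other, performs $r\cdot|E(g)|$ steps on each, and outputs the resulting graph. *Algorithm 2* with parameter $m\in\mathbb N$ starts from $G$ and performs $m$ times the following: choose $g\in\mathcal G$ at random, by a fixed law that gives every member of $\mathcal G$ positive probability, and perform one step on $g$ (nothing happens if $\mathcal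 G$ is empty). **Theorem.** For undirected as well as for directed $G$, both algorithms sample uniformly from $\mathcal N^d_G(c^{(0)})$, in the following sense. - The graphs that the algorithm outputs with positive probability for some value of its parameter ($r$, respectively $m$) are exactly the elements of $\mathcal N^d_G(c^{(0)})$. - For every value of the parameter, the transition matrix on $\mathcal N^d_G(c^{(0)})$, whose entry at $(F,H)$ is the probability that the algorithm, run with the above $c$ and $\mathcal G$ but started from $F$ instead of $G$, outputs $H$, is doubly stochastic. - As the parameter tends to infinity, the law of the output converges to the uniform distribution on $\mathcal N^d_G(c^{(0)})$: the probability of the output $H$ tends to $1/|\mathcal N^d_G(c^{(0)})|$ if $H\in\mathcal N^d_G(c^{(0)})$ and to $0$ otherwise. -/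

import Mathlib

open scoped Classical ENNReal Topology

namespace NeSt

section Generic

/-- One round of colour refinement: the new colour of `v` is the hash of its old colour and of the
multiset of old colours of its neighbours (undirected graphs). -/
noncomputable def refine {V K : Type*} [Fintype V] (hash : K × Multiset K → K) (c₀ : V → K)
    (G : SimpleGraph V) : ℕ → V → K
  | 0 => c₀
  | d + 1 => fun v =>
      hash (refine hash c₀ G d v,
        (Finset.univ.filter fun x => G.Adj v x).val.map (refine hash c₀ G d))

/-- Colour refinement for directed graphs, aggregating over both in- and out-neighbours
(in this order). -/
noncomputable def refineBoth {V K : Type*} [Fintype V] (hash : K × Multiset K × Multiset K → K)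
    (c₀ : V → K) (G : Digraph V) : ℕ → V → K
  | 0 => c₀
  | d + 1 => fun v =>
      hash (refineBoth hash c₀ G d v,
        (Finset.univ.filter fun x => G.Adj x v).val.map (refineBoth hash c₀ G d),
        (Finset.univ.filter fun x => G.Adj v x).val.map (refineBoth hash c₀ G d))

/-- All simple graphs on `V` whose nodes have the same `d`-round colours as in `G`. -/
def nest {V K : Type*} [Fintype V] (hash : K × Multiset K → K) (c₀ : V → K) (d : ℕ)
    (G : SimpleGraph V) : Set (SimpleGraph V) :=
  {H | refine hash c₀ H d = refine hash c₀ G d}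

/-- All directed graphs on `V` without self-loops whose nodes have the same `d`-round colours as
in `G`. -/
def dinest {V K : Type*} [Fintype V] (hash : K × Multiset K × Multiset K → K) (c₀ : V → K) (d : ℕ)
    (G : Digraph V) : Set (Digraph V) :=
  {H | (∀ v, ¬ H.Adj v v) ∧ refineBoth hash c₀ H d = refineBoth hash c₀ G d}

/-- The node set `C_i ∪ C_j` of the subgraph belonging to the colour pair `p = (i, j)`. -/
noncomputable def pairNodes {V K : Type*} [Fintype V] (c : V → K) (p : K × K) : Finset V :=
  Finset.univ.filter fun v => c v = p.1 ∨ c v = p.2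

/-- The edge set `{xy | x ∈ C_i, y ∈ C_j, xy ∈ E}` of the subgraph belonging to the colour pair
`p = (i, j)`. For an undirected graph and `i = j` every edge occurs in both orientations. -/
noncomputable def pairEdges {V K : Type*} [Fintype V] (adj : V → V → Prop) (c : V → K)
    (p : K × K) : Finset (V × V) :=
  Finset.univ.filter fun e => adj e.1 e.2 ∧ c e.1 = p.1 ∧ c e.2 = p.2

/-- Draw an element of `S` uniformly at random and continue with `k`; stop with `x` if there is
nothing to draw from. -/
noncomputable def draw {α β : Type*} (S : Finset α) (x : β) (k : α → PMF β) : PMF β :=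
  if h : S.Nonempty then (PMF.uniformOfFinset S h).bind k else PMF.pure x

/-- The law of the state after a number of steps of a Markov kernel. -/
noncomputable def iter {α : Type*} (κ : α → PMF α) : ℕ → α → PMF α
  | 0, x => PMF.pure x
  | n + 1, x => (κ x).bind (iter κ n)

/-- The first procedure: visit the colour pairs `p` of the list in turn, performing
`r * |E(g_p)|` steps of the kernel `step p` on each of them. -/
noncomputable def visitAll {α K : Type*} (step : K × K → α → PMF α) (size : K × K → α → ℕ) (r : ℕ) :
    List (K × K) → α → PMF α
  | [], x => PMF.pure x
  | p :: L, x => (iter (step p) (r * size p x) x).bind (visitAll step size r L)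

/-- One step of the second procedure: choose a colour pair from the list according to a fixed law
and perform one step of the kernel on it. If the list is empty, nothing happens. -/
noncomputable def visitRandom {α K : Type*} (step : K × K → α → PMF α) (L : List (K × K))
    (sel : L ≠ [] → PMF {p // p ∈ L}) (x : α) : PMF α :=
  if h : L ≠ [] then (sel h).bind fun p => step p x else PMF.pure x

/-- Here `out m z` is the law of the output of a random procedure with running parameter `m`
(controlling the number of steps) started in `z`. The procedure, started in `x`, samples uniformly
from `S`: its possible outputs are exactly the elements of `S`, it is doubly stochastic on `S`
(that is, it preserves the uniform distribution on `S`), and as `m → ∞` the law of its output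
converges to the uniform distribution on `S`. -/
def SamplesUniformly {α : Type*} (S : Set α) (out : ℕ → α → PMF α) (x : α) : Prop :=
  (⋃ m, (out m x).support) = S ∧
  (∀ m, ∀ y ∈ S, ∑' z : S, out m z y = 1) ∧
  ∀ y, Filter.Tendsto (fun m => out m x y) Filter.atTop
    (𝓝 (if y ∈ S then (S.ncard : ℝ≥0∞)⁻¹ else 0))

end Generic

section Undirected

/-- `L` lists the nonempty subgraphs of an undirected graph, each once, every subgraph being named
by one of the two orderings of its unordered pair of colours. -/
def IsPairList {V K : Type*} (G : SimpleGraph V) (c : V → K) (L : List (K × K)) : Prop :=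
  (L.map fun p => s(p.1, p.2)).Nodup ∧
  ∀ z : Sym2 K, z ∈ (L.map fun p => s(p.1, p.2)) ↔ ∃ u v, G.Adj u v ∧ z = s(c u, c v)

/-- Remove `u₁v₁, u₂v₂` and add `u₁v₂, u₂v₁` (`e₁ = u₁v₁` and `e₂ = u₂v₂`), provided that the four
nodes are distinct and the new edges are not yet present in the subgraph. -/
noncomputable def switch {V K : Type*} [Fintype V] (c : V → K) (p : K × K) (e₁ e₂ : V × V)
    (G : SimpleGraph V) : SimpleGraph V :=
  if ({e₁.1, e₁.2, e₂.1, e₂.2} : Finset V).card = 4 ∧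
      (e₁.1, e₂.2) ∉ pairEdges G.Adj c p ∧ (e₂.1, e₁.2) ∉ pairEdges G.Adj c p then
    G.deleteEdges {s(e₁.1, e₁.2), s(e₂.1, e₂.2)} ⊔
      SimpleGraph.fromEdgeSet {s(e₁.1, e₂.2), s(e₂.1, e₁.2)}
  else G

/-- One step on the subgraph `p` of an undirected graph: an attempted switch of two random edges.
(The triangle reversals are void here: an undirected graph has no directed triangle.) -/
noncomputable def step {V K : Type*} [Fintype V] (c : V → K) (p : K × K) (G : SimpleGraph V) :
    PMF (SimpleGraph V) :=
  draw (pairEdges G.Adj c p) G fun e₁ =>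
    draw (pairEdges G.Adj c p) G fun e₂ => PMF.pure (switch c p e₁ e₂ G)

/-- The first procedure on undirected graphs. -/
noncomputable def algorithmOne {V K : Type*} [Fintype V] (c : V → K) (L : List (K × K)) (r : ℕ) :
    SimpleGraph V → PMF (SimpleGraph V) :=
  visitAll (step c) (fun p G => (pairEdges G.Adj c p).card) r L

/-- The second procedure on undirected graphs, with `m` steps. -/
noncomputable def algorithmTwo {V K : Type*} [Fintype V] (c : V → K) (L : List (K × K))
    (sel : L ≠ [] → PMF {p // p ∈ L}) (m : ℕ) : SimpleGraph V → PMF (SimpleGraph V) :=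
  iter (visitRandom (step c) L sel) m

end Undirected

section Directed

/-- `L` lists the nonempty subgraphs of a directed graph, each once, named by their ordered pair of
colours. -/
def IsDiPairList {V K : Type*} (G : Digraph V) (c : V → K) (L : List (K × K)) : Prop :=
  L.Nodup ∧ ∀ p : K × K, p ∈ L ↔ ∃ u v, G.Adj u v ∧ p = (c u, c v)

/-- Remove the edges in `R` and add those in `A`. -/
def edit {V : Type*} (G : Digraph V) (R A : Set (V × V)) : Digraph V where
  Adj x y := (G.Adj x y ∧ (x, y) ∉ R) ∨ (x, y) ∈ A

/-- Remove `u₁v₁, u₂v₂` and add `u₁v₂, u₂v₁` (`e₁ = u₁v₁` and `e₂ = u₂v₂`), provided that the four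
nodes are distinct and the new edges are not yet present in the subgraph. -/
noncomputable def diswitch {V K : Type*} [Fintype V] (c : V → K) (p : K × K) (e₁ e₂ : V × V)
    (G : Digraph V) : Digraph V :=
  if ({e₁.1, e₁.2, e₂.1, e₂.2} : Finset V).card = 4 ∧
      (e₁.1, e₂.2) ∉ pairEdges G.Adj c p ∧ (e₂.1, e₁.2) ∉ pairEdges G.Adj c p then
    edit G {e₁, e₂} {(e₁.1, e₂.2), (e₂.1, e₁.2)}
  else G

/-- The edges between the three nodes in the subgraph are exactly `u₁u₂, u₂u₃, u₃u₁`. -/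
def IsDiTriangle {V K : Type*} [Fintype V] (G : Digraph V) (c : V → K) (p : K × K)
    (u₁ u₂ u₃ : V) : Prop :=
  ((u₁, u₂) ∈ pairEdges G.Adj c p ∧ (u₂, u₃) ∈ pairEdges G.Adj c p ∧
    (u₃, u₁) ∈ pairEdges G.Adj c p) ∧
  ((u₂, u₁) ∉ pairEdges G.Adj c p ∧ (u₃, u₂) ∉ pairEdges G.Adj c p ∧
    (u₁, u₃) ∉ pairEdges G.Adj c p)

/-- Reverse the direction of the triangle `u₁, u₂, u₃` if it is one. -/
noncomputable def reverseTriangle {V K : Type*} [Fintype V] (c : V → K) (p : K × K) (u₁ u₂ u₃ : V)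
    (G : Digraph V) : Digraph V :=
  if IsDiTriangle G c p u₁ u₂ u₃ then
    edit G {(u₁, u₂), (u₂, u₃), (u₃, u₁)} {(u₂, u₁), (u₃, u₂), (u₁, u₃)}
  else G

/-- One step on the subgraph `p` of a directed graph: an attempted switch of two random edges, and
then, if the edges join nodes of equal colour, an attempted reversal of the triangle on three random
nodes of the subgraph. -/
noncomputable def distep {V K : Type*} [Fintype V] (c : V → K) (p : K × K) (G : Digraph V) :
    PMF (Digraph V) :=
  draw (pairEdges G.Adj c p) G fun e₁ =>
    draw (pairEdges G.Adj c p) G fun e₂ =>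
      if c e₁.1 = c e₁.2 then
        draw (pairNodes c p) (diswitch c p e₁ e₂ G) fun u₁ =>
          draw (pairNodes c p) (diswitch c p e₁ e₂ G) fun u₂ =>
            draw (pairNodes c p) (diswitch c p e₁ e₂ G) fun u₃ =>
              PMF.pure (reverseTriangle c p u₁ u₂ u₃ (diswitch c p e₁ e₂ G))
      else PMF.pure (diswitch c p e₁ e₂ G)

/-- The first procedure on directed graphs. -/
noncomputable def diAlgorithmOne {V K : Type*} [Fintype V] (c : V → K) (L : List (K × K)) (r : ℕ) :
    Digraph V → PMF (Digraph V) :=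
  visitAll (distep c) (fun p G => (pairEdges G.Adj c p).card) r L

/-- The second procedure on directed graphs, with `m` steps. -/
noncomputable def diAlgorithmTwo {V K : Type*} [Fintype V] (c : V → K) (L : List (K × K))
    (sel : L ≠ [] → PMF {p // p ∈ L}) (m : ℕ) : Digraph V → PMF (Digraph V) :=
  iter (visitRandom (distep c) L sel) m

end Directed

end NeSt

/-! Since `hash` is injective, a graph has the colours of G after d rounds exactly when, for the
colouring c of round d - 1, every node has as many neighbours of each colour (in- and out-neighbours
separately in the directed case) as it has in G. The set to be sampled is therefore a product: a
graph in it amounts to an independent choice, for each colour pair, of an edge set between the two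
classes with prescribed degrees (`nest_succ_eq`, `dinest_succ_eq`).

A step changes a single factor. A switch is undone by a switch and a reversal by a reversal, with
the same probability, so a step is a symmetric kernel or a composite of two, hence doubly
stochastic. Drawing the same edge twice, and the same node three times, leaves the graph unchanged,
so the chain has loops. It is irreducible on its factor: undirected graphs with equal degrees are
connected by switches (`reflTransGen_unSwitch`), loopless digraphs by switches and triangle
reversals (`reflTransGen_diStep`); both are shown by repairing the out-neighbourhoods of one node
after another. An irreducible doubly stochastic chain with loops converges to the uniform law
(`tendsto_iter`).

`BlockChain` collects what both kinds of graphs have in common. Algorithm 1 randomises the factors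
in turn, with a number of steps that is constant on the set, and its limit law is the product of the
uniform laws of the factors. Algorithm 2 is one irreducible chain with loops on the whole product.
-/

namespace NeSt

/-! ### Convergence of powers of doubly stochastic matrices -/

section Matrix

open Filter Matrix

variable {ι : Type*} [Fintype ι] [DecidableEq ι]

theorem eventually_pow_pos_of_connected {P : Matrix ι ι ℝ} (hP : P ∈ doublyStochastic ℝ ι)
    (hdiag : ∀ x, P x x ≠ 0)
    (hconn : ∀ x y, Relation.ReflTransGen (fun a b => P a b ≠ 0) x y) :
    ∀ᶠ n in atTop, ∀ x y, 0 < (P ^ n) x y := by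
  have hpow (n : ℕ) : P ^ n ∈ doublyStochastic ℝ ι := pow_mem hP n
  have hpos {a b : ι} (h : P a b ≠ 0) : 0 < P a b :=
    lt_of_le_of_ne (nonneg_of_mem_doublyStochastic hP) h.symm
  have hstep {n : ℕ} {x a b : ι} (h : 0 < (P ^ n) x a) (hab : P a b ≠ 0) :
      0 < (P ^ (n + 1)) x b := by
    rw [pow_succ, Matrix.mul_apply]
    exact Finset.sum_pos' (fun i _ => mul_nonneg (nonneg_of_mem_doublyStochastic (hpow n))
      (nonneg_of_mem_doublyStochastic hP)) ⟨a, Finset.mem_univ a, mul_pos h (hpos hab)⟩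
  rw [eventually_all]
  intro x
  rw [eventually_all]
  intro y
  obtain ⟨n, hn⟩ : ∃ n : ℕ, 0 < (P ^ n) x y := by
    induction hconn x y with
    | refl => exact ⟨0, by simp⟩
    | tail _ hab ih =>
      obtain ⟨n, hn⟩ := ih
      exact ⟨n + 1, hstep hn hab⟩
  filter_upwards [eventually_ge_atTop n] with m hm
  induction m, hm using Nat.le_induction with
  | base => exact hn
  | succ m _ ih => exact hstep ih (hdiag y)

/-- Doeblin's contraction: on a vector of sum zero, subtracting ε from every entry of Q changes
nothing, and the remaining matrix is nonnegative with row sums 1 - |ι| ε. -/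
theorem norm_mulVec_le_of_doublyStochastic {Q : Matrix ι ι ℝ} (hQ : Q ∈ doublyStochastic ℝ ι)
    {ε : ℝ} (hε : ∀ x y, ε ≤ Q x y) (hε1 : 0 ≤ 1 - Fintype.card ι * ε) {g : ι → ℝ}
    (hg : ∑ z, g z = 0) :
    ‖Q *ᵥ g‖ ≤ (1 - Fintype.card ι * ε) * ‖g‖ := by
  rw [pi_norm_le_iff_of_nonneg (mul_nonneg hε1 (norm_nonneg g))]
  intro x
  have h1 : (Q *ᵥ g) x = ∑ z, (Q x z - ε) * g z := by
    simp [Matrix.mulVec, dotProduct, sub_mul, Finset.sum_sub_distrib, ← Finset.mul_sum, hg]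
  calc ‖(Q *ᵥ g) x‖ = ‖∑ z, (Q x z - ε) * g z‖ := by rw [h1]
    _ ≤ ∑ z, (Q x z - ε) * ‖g‖ := by
      refine (norm_sum_le _ _).trans (Finset.sum_le_sum fun z _ => ?_)
      rw [norm_mul, Real.norm_of_nonneg (sub_nonneg.2 (hε x z))]
      exact mul_le_mul_of_nonneg_left (norm_le_pi_norm g z) (sub_nonneg.2 (hε x z))
    _ = (1 - Fintype.card ι * ε) * ‖g‖ := by
      rw [← Finset.sum_mul, Finset.sum_sub_distrib, sum_row_of_mem_doublyStochastic hQ]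
      simp

/-- The powers of an irreducible doubly stochastic matrix with nonzero diagonal converge to the
uniform matrix. -/
theorem tendsto_pow_of_doublyStochastic {P : Matrix ι ι ℝ} (hP : P ∈ doublyStochastic ℝ ι)
    (hdiag : ∀ x, P x x ≠ 0)
    (hconn : ∀ x y, Relation.ReflTransGen (fun a b => P a b ≠ 0) x y) (x y : ι) :
    Tendsto (fun n => (P ^ n) x y) atTop (𝓝 (Fintype.card ι : ℝ)⁻¹) := by
  have hpow (n : ℕ) : P ^ n ∈ doublyStochastic ℝ ι := pow_mem hP n
  have : Nonempty ι := ⟨x⟩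
  have hcard : (0 : ℝ) < Fintype.card ι := by exact_mod_cast Fintype.card_pos
  -- All entries of `P ^ N` are at least some ε > 0, so N steps contract by the factor ρ < 1. The
  -- bound 1 ≤ N is for the later division by N.
  obtain ⟨N, hNpos, hN⟩ := ((eventually_pow_pos_of_connected hP hdiag hconn).and
    (eventually_ge_atTop 1)).exists
  obtain ⟨p, hp⟩ := Finite.exists_min fun p : ι × ι => (P ^ N) p.1 p.2
  set ε := (P ^ N) p.1 p.2 with hεdef
  have hε : ∀ x y, ε ≤ (P ^ N) x y := fun x y => hp (x, y)
  have hε0 : 0 < ε := hNpos _ _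
  set ρ := 1 - Fintype.card ι * ε with hρ
  have hρ0 : 0 ≤ ρ := by
    have h := sum_row_of_mem_doublyStochastic (hpow N) x
    have h2 : ∑ _z : ι, ε ≤ ∑ z, (P ^ N) x z := Finset.sum_le_sum fun z _ => hε x z
    rw [h] at h2
    simp only [Finset.sum_const, Finset.card_univ, nsmul_eq_mul] at h2
    linarith
  have hρ1 : ρ < 1 := by have := mul_pos hcard hε0; linarith
  -- The deviation of column y from uniformity; it has sum zero because columns sum to 1.
  let h : ℕ → ι → ℝ := fun n z => (P ^ n) z y - (Fintype.card ι : ℝ)⁻¹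
  have hsum (n : ℕ) : ∑ z, h n z = 0 := by
    simp only [h, Finset.sum_sub_distrib, sum_col_of_mem_doublyStochastic (hpow n)]
    simp [hcard.ne']
  have hadd (m n : ℕ) : h (m + n) = (P ^ m) *ᵥ h n := by
    ext z
    simp only [h, pow_add, Matrix.mul_apply, Matrix.mulVec, dotProduct, mul_sub,
      Finset.sum_sub_distrib, ← Finset.sum_mul, sum_row_of_mem_doublyStochastic (hpow m), one_mul]
  -- The case ε = 0 of the contraction covers the steps between multiples of N.
  have hanti : Antitone fun n => ‖h n‖ := by
    refine antitone_nat_of_succ_le fun n => ?_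
    have := norm_mulVec_le_of_doublyStochastic hP (ε := 0)
      (fun _ _ => nonneg_of_mem_doublyStochastic hP) (by simp) (hsum n)
    rw [add_comm, hadd, pow_one]
    simpa using this
  have hgeom (k : ℕ) : ‖h (N * k)‖ ≤ ρ ^ k * ‖h 0‖ := by
    induction k with
    | zero => simp
    | succ k ih =>
      have := norm_mulVec_le_of_doublyStochastic (hpow N) hε hρ0 (hsum (N * k))
      rw [mul_add, mul_one, add_comm, hadd, pow_succ', mul_assoc]
      exact this.trans (mul_le_mul_of_nonneg_left ih hρ0)
  have hlim : Tendsto (fun n => ‖h n‖) atTop (𝓝 0) := by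
    have h1 : Tendsto (fun n : ℕ => ρ ^ (n / N) * ‖h 0‖) atTop (𝓝 0) := by
      have := ((tendsto_pow_atTop_nhds_zero_of_lt_one hρ0 hρ1).comp
        (Nat.tendsto_div_const_atTop (by omega : N ≠ 0))).mul_const ‖h 0‖
      simpa using this
    refine squeeze_zero (fun n => norm_nonneg _) (fun n => ?_) h1
    exact (hanti (Nat.mul_div_le n N)).trans (hgeom _)
  have h2 : Tendsto (fun n => h n x) atTop (𝓝 0) :=
    squeeze_zero_norm (fun n => norm_le_pi_norm (h n) x) hlim
  have h3 := h2.add_const (Fintype.card ι : ℝ)⁻¹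
  simpa [h] using h3

end Matrix

/-! ### Doubly stochastic kernels on a subset -/

section Kernel

open Filter

variable {α : Type*}

/-- The kernel `κ` maps `S` to itself and preserves the counting measure of `S`. -/
structure DoublyStochasticOn (S : Set α) (κ : α → PMF α) : Prop where
  mem_of_ne_zero : ∀ x ∈ S, ∀ y, κ x y ≠ 0 → y ∈ S
  sum_col : ∀ y ∈ S, ∑' z : S, κ z y = 1

theorem DoublyStochasticOn.congr {S : Set α} {κ κ' : α → PMF α} (h : DoublyStochasticOn S κ)
    (heq : ∀ x ∈ S, κ x = κ' x) : DoublyStochasticOn S κ' where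
  mem_of_ne_zero x hx y hy := h.mem_of_ne_zero x hx y (by rwa [heq x hx])
  sum_col y hy := by
    rw [← h.sum_col y hy]
    exact tsum_congr fun z => by rw [heq z z.2]

theorem DoublyStochasticOn.pure (S : Set α) : DoublyStochasticOn S PMF.pure where
  mem_of_ne_zero x hx y hy := by
    have : y = x := by simpa [PMF.pure_apply] using hy
    exact this ▸ hx
  sum_col y hy := by
    rw [tsum_eq_single (⟨y, hy⟩ : S)]
    · simp
    · rintro ⟨z, hz⟩ hne
      rw [PMF.pure_apply, if_neg]
      rintro rfl
      exact hne rfl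

/-- For a kernel that does not leave `S`, it suffices to sum over `S`. -/
theorem bind_apply_of_mem {S : Set α} {κ : α → PMF α} (h : ∀ x ∈ S, ∀ y, κ x y ≠ 0 → y ∈ S)
    {x : α} (hx : x ∈ S) (κ' : α → PMF α) (y : α) :
    (κ x).bind κ' y = ∑' z : S, κ x z * κ' z y := by
  rw [PMF.bind_apply, tsum_subtype S fun z => κ x z * κ' z y]
  refine tsum_congr fun z => ?_
  by_cases hz : z ∈ S
  · rw [Set.indicator_of_mem hz]
  · rw [Set.indicator_of_notMem hz, not_ne_iff.1 fun h0 => hz (h x hx z h0), zero_mul]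

theorem DoublyStochasticOn.bind {S : Set α} {κ κ' : α → PMF α} (h : DoublyStochasticOn S κ)
    (h' : DoublyStochasticOn S κ') : DoublyStochasticOn S fun x => (κ x).bind κ' where
  mem_of_ne_zero x hx y hy := by
    obtain ⟨z, hz, hzy⟩ := (PMF.mem_support_bind_iff _ _ _).1 ((PMF.mem_support_iff _ _).2 hy)
    exact h'.mem_of_ne_zero z (h.mem_of_ne_zero x hx z hz) y hzy
  sum_col y hy := by
    calc ∑' z : S, (κ z).bind κ' y = ∑' z : S, ∑' w : S, κ z w * κ' w y :=
          tsum_congr fun z => bind_apply_of_mem h.mem_of_ne_zero z.2 κ' y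
      _ = ∑' w : S, (∑' z : S, κ z w) * κ' w y := by
          rw [ENNReal.tsum_comm]
          exact tsum_congr fun w => ENNReal.tsum_mul_right
      _ = ∑' w : S, κ' w y := tsum_congr fun w => by rw [h.sum_col w w.2, one_mul]
      _ = 1 := h'.sum_col y hy

theorem DoublyStochasticOn.iter {S : Set α} {κ : α → PMF α} (h : DoublyStochasticOn S κ) (n : ℕ) :
    DoublyStochasticOn S (iter κ n) := by
  induction n with
  | zero => exact DoublyStochasticOn.pure S
  | succ n ih => exact h.bind ih

theorem DoublyStochasticOn.mix {ι : Type*} {S : Set α} {κ : ι → α → PMF α}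
    (h : ∀ i, DoublyStochasticOn S (κ i)) (q : PMF ι) :
    DoublyStochasticOn S fun x => q.bind fun i => κ i x where
  mem_of_ne_zero x hx y hy := by
    obtain ⟨i, _, hi⟩ := (PMF.mem_support_bind_iff _ _ _).1 ((PMF.mem_support_iff _ _).2 hy)
    exact (h i).mem_of_ne_zero x hx y hi
  sum_col y hy := by
    simp only [PMF.bind_apply]
    rw [ENNReal.tsum_comm]
    simp only [ENNReal.tsum_mul_left, (h _).sum_col y hy, mul_one, q.tsum_coe]

/-- A kernel that is symmetric on `S` preserves the counting measure of `S`. -/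
theorem DoublyStochasticOn.of_symm {S : Set α} {κ : α → PMF α}
    (h : ∀ x ∈ S, ∀ y, κ x y ≠ 0 → y ∈ S) (hsymm : ∀ x ∈ S, ∀ y ∈ S, κ x y = κ y x) :
    DoublyStochasticOn S κ where
  mem_of_ne_zero := h
  sum_col y hy := by
    -- Binding with a constant kernel expresses that row y has sum 1 over S; by symmetry this is the
    -- column sum.
    have h1 := bind_apply_of_mem h hy (fun _ => PMF.pure y) y
    simp only [PMF.bind_const, PMF.pure_apply, if_true, mul_one] at h1
    rw [h1]
    exact tsum_congr fun z => hsymm z z.2 y hy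

/-- The law of an irreducible Markov chain with loops that preserves the counting measure of a
finite set converges to the uniform distribution. -/
theorem tendsto_iter [Finite α] {S : Set α} {κ : α → PMF α} (h : DoublyStochasticOn S κ)
    (hloop : ∀ x ∈ S, κ x x ≠ 0)
    (hconn : ∀ x ∈ S, ∀ y ∈ S, Relation.ReflTransGen (fun a b => κ a b ≠ 0) x y)
    {x y : α} (hx : x ∈ S) (hy : y ∈ S) :
    Tendsto (fun n => iter κ n x y) atTop (𝓝 (S.ncard : ℝ≥0∞)⁻¹) := by
  have : Fintype S := Fintype.ofFinite S
  let P : Matrix S S ℝ := fun a b => (κ a b).toReal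
  have hPne {a b : S} : P a b ≠ 0 ↔ κ a b ≠ 0 := by
    simp [P, ENNReal.toReal_eq_zero_iff, PMF.apply_ne_top]
  have hP : P ∈ doublyStochastic ℝ S := by
    rw [mem_doublyStochastic_iff_sum]
    refine ⟨fun a b => ENNReal.toReal_nonneg, fun a => ?_, fun b => ?_⟩
    · have h1 := bind_apply_of_mem h.mem_of_ne_zero a.2 (fun _ => PMF.pure y) y
      simp only [PMF.bind_const, PMF.pure_apply, if_true, mul_one] at h1
      simp only [P]
      rw [← ENNReal.toReal_sum fun b _ => PMF.apply_ne_top _ _,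
        ← tsum_fintype (L := .unconditional _), ← h1, ENNReal.toReal_one]
    · have h1 := h.sum_col b b.2
      simp only [P]
      rw [← ENNReal.toReal_sum fun b _ => PMF.apply_ne_top _ _,
        ← tsum_fintype (L := .unconditional _), h1, ENNReal.toReal_one]
  have hiter (n : ℕ) : ∀ a b : S, iter κ n a b = ENNReal.ofReal ((P ^ n) a b) := by
    induction n with
    | zero =>
      intro a b
      by_cases hab : a = b
      · subst hab; simp [iter]
      · have : (b : α) ≠ a := fun h0 => hab (Subtype.ext h0.symm)
        simp [iter, PMF.pure_apply, this, Matrix.one_apply_ne hab]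
    | succ n ih =>
      intro a b
      have hn := pow_mem hP n
      rw [pow_succ', Matrix.mul_apply, ENNReal.ofReal_sum_of_nonneg]
      · simp only [iter]
        rw [bind_apply_of_mem h.mem_of_ne_zero a.2, tsum_fintype]
        refine Finset.sum_congr rfl fun z _ => ?_
        rw [ENNReal.ofReal_mul ENNReal.toReal_nonneg, ENNReal.ofReal_toReal (PMF.apply_ne_top _ _),
          ih]
      · exact fun z _ => mul_nonneg (nonneg_of_mem_doublyStochastic hP)
          (nonneg_of_mem_doublyStochastic hn)
  have hconn' (a b : S) : Relation.ReflTransGen (fun a b => P a b ≠ 0) a b := by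
    obtain ⟨a, ha⟩ := a
    obtain ⟨b, hb⟩ := b
    induction hconn a ha b hb using Relation.ReflTransGen.head_induction_on with
    | refl => exact .refl
    | head hac _ ih =>
      have hc := h.mem_of_ne_zero _ ha _ hac
      exact .head (b := ⟨_, hc⟩) (hPne.2 hac) (ih hc)
  have key := tendsto_pow_of_doublyStochastic hP (fun a => hPne.2 (hloop a a.2)) hconn'
    ⟨x, hx⟩ ⟨y, hy⟩
  have hcard : (S.ncard : ℝ≥0∞)⁻¹ = ENNReal.ofReal (Fintype.card S : ℝ)⁻¹ := by
    have : 0 < Fintype.card S := Fintype.card_pos_iff.2 ⟨⟨x, hx⟩⟩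
    rw [ENNReal.ofReal_inv_of_pos (by exact_mod_cast this), ENNReal.ofReal_natCast,
      ← Nat.card_coe_set_eq, Nat.card_eq_fintype_card]
  rw [hcard]
  exact (ENNReal.tendsto_ofReal key).congr fun n => (hiter n ⟨x, hx⟩ ⟨y, hy⟩).symm

end Kernel

/-! ### Chains on a product of components -/

section Blocks

open Filter

variable {α K B : Type*}

/-- The limit settles the support as well: 1/|S| is nonzero, so every element of S has positive
probability for some parameter. -/
theorem samplesUniformly_of_tendsto [Finite α] {S : Set α} {out : ℕ → α → PMF α}
    (h : ∀ m, DoublyStochasticOn S (out m)) {x : α} (hx : x ∈ S)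
    (hlim : ∀ y ∈ S, Tendsto (fun m => out m x y) atTop (𝓝 (S.ncard : ℝ≥0∞)⁻¹)) :
    SamplesUniformly S out x := by
  refine ⟨Set.Subset.antisymm ?_ fun y hy => ?_, fun m y hy => (h m).sum_col y hy, fun y => ?_⟩
  · exact Set.iUnion_subset fun m y hy => (h m).mem_of_ne_zero x hx y hy
  · have hne : (S.ncard : ℝ≥0∞)⁻¹ ≠ 0 := ENNReal.inv_ne_zero.2 (ENNReal.natCast_ne_top _)
    obtain ⟨m, hm⟩ := ((hlim y hy).eventually_ne hne).exists
    exact Set.mem_iUnion.2 ⟨m, hm⟩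
  · by_cases hy : y ∈ S
    · rw [if_pos hy]
      exact hlim y hy
    · rw [if_neg hy]
      have h0 (m : ℕ) : out m x y = 0 := not_ne_iff.1 fun h0 => hy ((h m).mem_of_ne_zero x hx y h0)
      simp only [h0, tendsto_const_nhds]

/-- Markov kernels `κ p` on `S`, for `p` in the list `L`, such that an element of `S` amounts to an
independent choice of its components `res p`, and `κ p` is an irreducible chain in the component
`p` that leaves the other components alone. -/
structure BlockChain (S : Set α) (L : List (K × K)) (κ : K × K → α → PMF α) (size : K × K → α → ℕ)
    (res : K × K → α → B) : Prop where
  nodup : L.Nodup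
  doublyStochastic : ∀ p ∈ L, DoublyStochasticOn S (κ p)
  loop : ∀ p ∈ L, ∀ x ∈ S, κ p x x ≠ 0
  res_eq : ∀ p ∈ L, ∀ x ∈ S, ∀ y, κ p x y ≠ 0 → ∀ q ∈ L, q ≠ p → res q y = res q x
  size_eq : ∀ p ∈ L, ∀ x ∈ S, ∀ y ∈ S, size p x = size p y
  size_pos : ∀ p ∈ L, ∀ x ∈ S, 0 < size p x
  connected : ∀ p ∈ L, ∀ x ∈ S, ∀ y ∈ S, (∀ q ∈ L, q ≠ p → res q y = res q x) →
    Relation.ReflTransGen (fun a b => κ p a b ≠ 0) x y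
  ext : ∀ x ∈ S, ∀ y ∈ S, (∀ q ∈ L, res q x = res q y) → x = y
  combine : ∀ p ∈ L, ∀ x ∈ S, ∀ y ∈ S, ∃ z ∈ S, res p z = res p y ∧
    ∀ q ∈ L, q ≠ p → res q z = res q x

namespace BlockChain

variable {S : Set α} {L : List (K × K)} {κ : K × K → α → PMF α} {size : K × K → α → ℕ} {res : K × K → α → B}

/-- The chain `κ p` lives on the fibre T of states that agree with x off p, and is irreducible
there. By `ext` and `combine`, `res p` maps T bijectively onto `res p '' S`, so all fibres have the
same size. -/
theorem tendsto_iter_block [Finite α] (h : BlockChain S L κ size res) {p : K × K} (hp : p ∈ L) {x y : α}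
    (hx : x ∈ S) (hy : y ∈ S) :
    Tendsto (fun n => iter (κ p) n x y) atTop
      (𝓝 (if ∀ q ∈ L, q ≠ p → res q y = res q x then ((res p '' S).ncard : ℝ≥0∞)⁻¹ else 0)) := by
  set T : Set α := {z | z ∈ S ∧ ∀ q ∈ L, q ≠ p → res q z = res q x} with hT
  have hTS : T ⊆ S := fun z hz => hz.1
  have hmem : ∀ z ∈ T, ∀ w, κ p z w ≠ 0 → w ∈ T := fun z hz w hw =>
    ⟨(h.doublyStochastic p hp).mem_of_ne_zero z hz.1 w hw,
      fun q hq hqp => (h.res_eq p hp z hz.1 w hw q hq hqp).trans (hz.2 q hq hqp)⟩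
  have hds : DoublyStochasticOn T (κ p) := by
    refine ⟨hmem, fun w hw => ?_⟩
    rw [← (h.doublyStochastic p hp).sum_col w hw.1, tsum_subtype T fun z => κ p z w,
      tsum_subtype S fun z => κ p z w]
    refine tsum_congr fun z => ?_
    by_cases hzT : z ∈ T
    · rw [Set.indicator_of_mem hzT, Set.indicator_of_mem (hTS hzT)]
    · rw [Set.indicator_of_notMem hzT]
      by_cases hzS : z ∈ S
      · rw [Set.indicator_of_mem hzS]
        -- A state of S from which `κ p` enters T already agrees with x off p, so column sums over T
        -- and over S coincide.
        by_contra hne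
        exact hzT ⟨hzS, fun q hq hqp =>
          (h.res_eq p hp z hzS w (Ne.symm hne) q hq hqp).symm.trans (hw.2 q hq hqp)⟩
      · rw [Set.indicator_of_notMem hzS]
  have hxT : x ∈ T := ⟨hx, fun _ _ _ => rfl⟩
  by_cases hyT : y ∈ T
  · rw [if_pos hyT.2]
    have hcard : (res p '' S).ncard = T.ncard := by
      have himg : res p '' S = res p '' T := by
        refine Set.Subset.antisymm ?_ (Set.image_mono hTS)
        rintro _ ⟨z, hz, rfl⟩
        obtain ⟨w, hw, hwp, hwq⟩ := h.combine p hp x hx z hz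
        exact ⟨w, ⟨hw, hwq⟩, hwp⟩
      rw [himg]
      refine Set.InjOn.ncard_image fun z hz w hw hzw => h.ext z hz.1 w hw.1 fun q hq => ?_
      by_cases hqp : q = p
      · exact hqp ▸ hzw
      · rw [hz.2 q hq hqp, hw.2 q hq hqp]
    rw [hcard]
    refine tendsto_iter hds (fun z hz => h.loop p hp z hz.1) (fun z hz w hw => ?_) hxT hyT
    exact h.connected p hp z hz.1 w hw.1 fun q hq hqp => by rw [hz.2 q hq hqp, hw.2 q hq hqp]
  · rw [if_neg fun h0 => hyT ⟨hy, h0⟩]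
    have h0 (n : ℕ) : iter (κ p) n x y = 0 :=
      not_ne_iff.1 fun h0 => hyT ((hds.iter n).mem_of_ne_zero x hxT y h0)
    simp only [h0, tendsto_const_nhds]

/-- The number of steps is read off the current state, but it is constant on S, so each visit is a
fixed iterate of `κ p`. -/
theorem doublyStochasticOn_visitAll (h : BlockChain S L κ size res) (r : ℕ) {L' : List (K × K)}
    (hL : L' ⊆ L) : DoublyStochasticOn S (visitAll κ size r L') := by
  induction L' with
  | nil => exact DoublyStochasticOn.pure S
  | cons p L' ih =>
    have hp : p ∈ L := hL List.mem_cons_self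
    obtain hS | ⟨x₀, hx₀⟩ := S.eq_empty_or_nonempty
    · subst hS
      exact ⟨fun x hx => hx.elim, fun x hx => hx.elim⟩
    · refine (((h.doublyStochastic p hp).iter (r * size p x₀)).bind
        (ih fun q hq => hL (List.mem_cons_of_mem p hq))).congr fun x hx => ?_
      simp only [visitAll]
      rw [h.size_eq p hp x hx x₀ hx₀]

/-- Components outside `L'` stay those of x, while those in `L'` become independent and uniform. The
start x is general because the induction moves on to the state after the first visit. -/
theorem tendsto_visitAll [Finite α] (h : BlockChain S L κ size res) {L' : List (K × K)} (hL : L' ⊆ L)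
    (hnd : L'.Nodup) {x y : α} (hx : x ∈ S) (hy : y ∈ S) :
    Tendsto (fun r => visitAll κ size r L' x y) atTop
      (𝓝 (if ∀ q ∈ L, q ∉ L' → res q y = res q x then
        (L'.map fun p => ((res p '' S).ncard : ℝ≥0∞)⁻¹).prod else 0)) := by
  have : Fintype S := Fintype.ofFinite S
  induction L' generalizing x with
  | nil =>
    by_cases hxy : y = x
    · subst hxy
      simp [visitAll]
    · rw [if_neg fun h0 => hxy (h.ext y hy x hx fun q hq => h0 q hq List.not_mem_nil)]
      simp [visitAll, PMF.pure_apply, hxy]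
  | cons p L' ih =>
    have hp : p ∈ L := hL List.mem_cons_self
    have hpL' : p ∉ L' := (List.nodup_cons.1 hnd).1
    have hL' : L' ⊆ L := fun q hq => hL (List.mem_cons_of_mem p hq)
    -- The limits must be finite, since multiplication on `ℝ≥0∞` is not continuous at 0 · ∞.
    have hne (q : K × K) : ((res q '' S).ncard : ℝ≥0∞)⁻¹ ≠ ⊤ := by
      rw [ENNReal.inv_ne_top, Nat.cast_ne_zero]
      exact ((Set.ncard_pos (Set.toFinite _)).2 ((Set.nonempty_of_mem hx).image _)).ne'
    have hne' : (L'.map fun p => ((res p '' S).ncard : ℝ≥0∞)⁻¹).prod ≠ ⊤ := by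
      clear ih hnd hpL' hL hL'
      induction L' with
      | nil => simp
      | cons q L' ih =>
        rw [List.map_cons, List.prod_cons]
        exact ENNReal.mul_ne_top (hne q) ih
    have hsum (r : ℕ) : visitAll κ size r (p :: L') x y =
        ∑ z : S, iter (κ p) (r * size p x) x z * visitAll κ size r L' z y := by
      rw [← tsum_fintype (L := .unconditional _)]
      exact bind_apply_of_mem ((h.doublyStochastic p hp).iter _).mem_of_ne_zero hx _ y
    simp only [hsum]
    have hlim := tendsto_finsetSum (Finset.univ : Finset S) fun z _ => ENNReal.Tendsto.mul
      ((h.tendsto_iter_block hp hx z.2).comp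
        (tendsto_id.atTop_mul_const' (h.size_pos p hp x hx)))
      (Or.inr (by split_ifs <;> simp [hne']))
      (ih hL' (List.nodup_cons.1 hnd).2 z.2)
      (Or.inr (by split_ifs <;> first | exact hne p | simp))
    refine (hlim.congr fun r => rfl).trans_eq ?_
    congr 1
    by_cases hC : ∀ q ∈ L, q ∉ p :: L' → res q y = res q x
    · rw [if_pos hC, List.map_cons, List.prod_cons]
      -- w has the component p of y and the other components of x; it is the only intermediate state
      -- for which both limit factors are nonzero.
      obtain ⟨w, hw, hwp, hwq⟩ := h.combine p hp x hx y hy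
      rw [Finset.sum_eq_single (⟨w, hw⟩ : S)]
      · rw [if_pos hwq, if_pos]
        intro q hq hqL'
        by_cases hqp : q = p
        · rw [hqp, hwp]
        · rw [hwq q hq hqp]
          exact hC q hq (by simp [hqp, hqL'])
      · rintro ⟨z, hz⟩ _ hzw
        by_contra hne
        rw [← ne_eq, mul_ne_zero_iff] at hne
        have h1 : ∀ q ∈ L, q ≠ p → res q z = res q x := by
          by_contra h1
          exact hne.1 (if_neg h1)
        have h2 : ∀ q ∈ L, q ∉ L' → res q y = res q z := by
          by_contra h2
          exact hne.2 (if_neg h2)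
        refine hzw (Subtype.ext (h.ext z hz w hw fun q hq => ?_))
        by_cases hqp : q = p
        · subst hqp
          rw [hwp, h2 q hq hpL']
        · rw [h1 q hq hqp, hwq q hq hqp]
      · simp
    · rw [if_neg hC]
      refine Finset.sum_eq_zero fun z _ => ?_
      by_contra hne
      rw [← ne_eq, mul_ne_zero_iff] at hne
      have h1 : ∀ q ∈ L, q ≠ p → res q z = res q x := by
        by_contra h1
        exact hne.1 (if_neg h1)
      have h2 : ∀ q ∈ L, q ∉ L' → res q y = res q z := by
        by_contra h2
        exact hne.2 (if_neg h2)
      refine hC fun q hq hqL => ?_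
      rw [List.mem_cons, not_or] at hqL
      rw [h2 q hq hqL.2, h1 q hq hqL.1]

/-- The limit `a` does not depend on y, so total mass 1 forces it to be 1/|S|; |S| need not be
computed as a product. -/
theorem samplesUniformly_visitAll [Finite α] (h : BlockChain S L κ size res) {x : α} (hx : x ∈ S) :
    SamplesUniformly S (fun r => visitAll κ size r L) x := by
  have : Fintype S := Fintype.ofFinite S
  have hds (r : ℕ) := h.doublyStochasticOn_visitAll r (List.Subset.refl L)
  set a := (L.map fun p => ((res p '' S).ncard : ℝ≥0∞)⁻¹).prod with ha
  have hlim : ∀ y ∈ S, Tendsto (fun r => visitAll κ size r L x y) atTop (𝓝 a) := fun y hy => by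
    have := h.tendsto_visitAll (List.Subset.refl L) h.nodup hx hy
    rwa [if_pos fun q hq hq' => (hq' hq).elim] at this
  have hsum : Tendsto (fun r => ∑ y : S, visitAll κ size r L x y) atTop (𝓝 (∑ _y : S, a)) :=
    tendsto_finsetSum _ fun y _ => hlim y y.2
  have hone (r : ℕ) : ∑ y : S, visitAll κ size r L x y = 1 := by
    have h1 := bind_apply_of_mem (hds r).mem_of_ne_zero hx (fun _ => PMF.pure x) x
    simp only [PMF.bind_const, PMF.pure_apply, if_true, mul_one] at h1
    rw [h1, tsum_fintype]
  simp only [hone] at hsum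
  have h1 := tendsto_nhds_unique hsum tendsto_const_nhds
  rw [Finset.sum_const, Finset.card_univ, nsmul_eq_mul, ← Nat.card_eq_fintype_card,
    Nat.card_coe_set_eq] at h1
  refine samplesUniformly_of_tendsto hds hx fun y hy => ?_
  rw [← ENNReal.eq_inv_of_mul_eq_one_left ((mul_comm _ _).trans h1)]
  exact hlim y hy

/-- Every move of every `κ p` is a move of the mixture, since `sel` has full support. Irreducibility
on S follows by correcting the components one at a time. -/
theorem samplesUniformly_visitRandom [Finite α] (h : BlockChain S L κ size res)
    (sel : L ≠ [] → PMF {p // p ∈ L}) (hsel : ∀ h p, sel h p ≠ 0) {x : α} (hx : x ∈ S) :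
    SamplesUniformly S (fun m => iter (visitRandom κ L sel) m) x := by
  have hds : DoublyStochasticOn S (visitRandom κ L sel) := by
    by_cases hL : L ≠ []
    · refine (DoublyStochasticOn.mix (fun p : {p // p ∈ L} => h.doublyStochastic p p.2)
        (sel hL)).congr fun x _ => ?_
      simp [visitRandom, hL]
    · refine (DoublyStochasticOn.pure S).congr fun x _ => ?_
      simp [visitRandom, hL]
  have hpos {p : K × K} (hp : p ∈ L) {x y : α} (hxy : κ p x y ≠ 0) :
      visitRandom κ L sel x y ≠ 0 := by
    have hL : L ≠ [] := List.ne_nil_of_mem hp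
    rw [visitRandom, dif_pos hL]
    exact (PMF.mem_support_iff _ _).1 ((PMF.mem_support_bind_iff _ _ _).2
      ⟨⟨p, hp⟩, hsel hL ⟨p, hp⟩, hxy⟩)
  -- `L'` lists the components in which x and y may still differ.
  have hreach : ∀ L' : List (K × K), L' ⊆ L → ∀ x ∈ S, ∀ y ∈ S,
      (∀ q ∈ L, q ∉ L' → res q y = res q x) →
      Relation.ReflTransGen (fun a b => visitRandom κ L sel a b ≠ 0) x y := by
    intro L' hL
    induction L' with
    | nil =>
      intro x hx y hy hxy
      rw [h.ext x hx y hy fun q hq => (hxy q hq List.not_mem_nil).symm]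
    | cons p L' ih =>
      intro x hx y hy hxy
      have hp : p ∈ L := hL List.mem_cons_self
      obtain ⟨z, hz, hzp, hzq⟩ := h.combine p hp x hx y hy
      have hxz : Relation.ReflTransGen (fun a b => visitRandom κ L sel a b ≠ 0) x z :=
        Relation.ReflTransGen.mono (fun a b => hpos hp) _ _ (h.connected p hp x hx z hz hzq)
      refine hxz.trans (ih (fun q hq => hL (List.mem_cons_of_mem p hq)) z hz y hy
        fun q hq hqL' => ?_)
      by_cases hqp : q = p
      · rw [hqp, hzp]
      · rw [hzq q hq hqp]
        exact hxy q hq (by simp [hqp, hqL'])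
  refine samplesUniformly_of_tendsto (fun m => hds.iter m) hx fun y hy => tendsto_iter hds ?_
    (fun x hx y hy => hreach L (List.Subset.refl L) x hx y hy fun q hq hq' => (hq' hq).elim) hx hy
  intro z hz
  by_cases hL : L ≠ []
  · obtain ⟨p, hp⟩ := List.exists_mem_of_ne_nil L hL
    exact hpos hp (h.loop p hp z hz)
  · simp [visitRandom, hL]

end BlockChain

end Blocks

/-! ### Edge sets with prescribed degrees and the repair of discrepancies -/

section EdgeSets

variable {V : Type*}

/-- Remove the edges in `R` and add those in `A`. -/
noncomputable def replaceEdges (E R A : Finset (V × V)) : Finset (V × V) := (E \ R) ∪ A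

theorem mem_replaceEdges {E R A : Finset (V × V)} {e : V × V} :
    e ∈ replaceEdges E R A ↔ (e ∈ E ∧ e ∉ R) ∨ e ∈ A := by
  simp [replaceEdges]

/-- The edge sets have the same outdegrees and the same indegrees. -/
def SameDegrees (E F : Finset (V × V)) : Prop :=
  E.val.map Prod.fst = F.val.map Prod.fst ∧ E.val.map Prod.snd = F.val.map Prod.snd

theorem SameDegrees.refl (E : Finset (V × V)) : SameDegrees E E := ⟨rfl, rfl⟩

theorem SameDegrees.symm {E F : Finset (V × V)} (h : SameDegrees E F) : SameDegrees F E :=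
  ⟨h.1.symm, h.2.symm⟩

theorem SameDegrees.trans {E F H : Finset (V × V)} (h : SameDegrees E F) (h' : SameDegrees F H) :
    SameDegrees E H :=
  ⟨h.1.trans h'.1, h.2.trans h'.2⟩

theorem SameDegrees.card_eq {E F : Finset (V × V)} (h : SameDegrees E F) : E.card = F.card := by
  simpa using congrArg Multiset.card h.1

theorem sameDegrees_replaceEdges {E R A : Finset (V × V)} (hR : R ⊆ E) (hA : Disjoint A E)
    (h : SameDegrees A R) : SameDegrees (replaceEdges E R A) E := by
  have h1 : (replaceEdges E R A).val = (E \ R).val + A.val := by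
    have hd : Disjoint (E \ R) A := (hA.mono_right Finset.sdiff_subset).symm
    rw [replaceEdges, ← Finset.disjUnion_eq_union _ _ hd, Finset.disjUnion_val]
  have h2 : E.val = (E \ R).val + R.val := by
    rw [← Finset.disjUnion_val _ _ Finset.sdiff_disjoint, Finset.disjUnion_eq_union,
      Finset.sdiff_union_of_subset hR]
  constructor
  · rw [h1, h2, Multiset.map_add, Multiset.map_add, h.1]
  · rw [h1, h2, Multiset.map_add, Multiset.map_add, h.2]

theorem replaceEdges_replaceEdges {E R A : Finset (V × V)} (hR : R ⊆ E) (hA : Disjoint A E) :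
    replaceEdges (replaceEdges E R A) A R = E := by
  ext e
  have h1 := @hR e
  have h2 : e ∈ A → e ∉ E := fun h => Finset.disjoint_left.1 hA h
  simp only [mem_replaceEdges]
  tauto

variable [Fintype V]

noncomputable def outSet (E : Finset (V × V)) (x : V) : Finset V :=
  Finset.univ.filter fun y => (x, y) ∈ E

noncomputable def inSet (E : Finset (V × V)) (y : V) : Finset V :=
  Finset.univ.filter fun x => (x, y) ∈ E

@[simp] theorem mem_outSet {E : Finset (V × V)} {x y : V} : y ∈ outSet E x ↔ (x, y) ∈ E := by
  simp [outSet]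

@[simp] theorem mem_inSet {E : Finset (V × V)} {x y : V} : x ∈ inSet E y ↔ (x, y) ∈ E := by
  simp [inSet]

theorem count_map_fst (E : Finset (V × V)) (x : V) :
    (E.val.map Prod.fst).count x = (outSet E x).card := by
  rw [Multiset.count_map, ← Finset.filter_val]
  refine (Finset.card_bij (fun y _ => (x, y)) ?_ ?_ ?_).symm
  · simp
  · simp
  · rintro ⟨u, y⟩ h
    obtain ⟨h, rfl⟩ := Finset.mem_filter.1 h
    exact ⟨y, by simpa using h, rfl⟩

theorem count_map_snd (E : Finset (V × V)) (y : V) :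
    (E.val.map Prod.snd).count y = (inSet E y).card := by
  rw [Multiset.count_map, ← Finset.filter_val]
  refine (Finset.card_bij (fun x _ => (x, y)) ?_ ?_ ?_).symm
  · simp
  · simp
  · rintro ⟨x, u⟩ h
    obtain ⟨h, rfl⟩ := Finset.mem_filter.1 h
    exact ⟨x, by simpa using h, rfl⟩

theorem sameDegrees_iff {E F : Finset (V × V)} :
    SameDegrees E F ↔ (∀ x, (outSet E x).card = (outSet F x).card) ∧
      ∀ y, (inSet E y).card = (inSet F y).card := by
  simp only [SameDegrees, Multiset.ext, count_map_fst, count_map_snd]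

/-- A sequence of steps that replaces the edge `va` by `vb` and otherwise affects only edges
that leave nodes of `A` other than `v`. -/
def Shift (Step : Finset (V × V) → Finset (V × V) → Prop) (A : Finset V) (v a b : V)
    (E E' : Finset (V × V)) : Prop :=
  Relation.ReflTransGen Step E E' ∧ (∀ x ∉ A, ∀ y, (x, y) ∈ E' ↔ (x, y) ∈ E) ∧
    ∀ y, (v, y) ∈ E' ↔ ((v, y) ∈ E ∧ y ≠ a) ∨ y = b

theorem mem_of_reflTransGen {α : Type*} {Step : α → α → Prop} {S : Set α}
    (h : ∀ x ∈ S, ∀ y, Step x y → y ∈ S) {x y : α} (hx : x ∈ S)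
    (hxy : Relation.ReflTransGen Step x y) : y ∈ S := by
  induction hxy with
  | refl => exact hx
  | tail _ hbc ih => exact h _ ih _ hbc

theorem reflTransGen_symm_on {α : Type*} {Step : α → α → Prop} {S : Set α}
    (h : ∀ x ∈ S, ∀ y, Step x y → y ∈ S ∧ Step y x) {x y : α} (hx : x ∈ S)
    (hxy : Relation.ReflTransGen Step x y) : Relation.ReflTransGen Step y x := by
  induction hxy with
  | refl => exact .refl
  | tail hab hbc ih =>
    exact .head (h _ (mem_of_reflTransGen (fun x hx y hxy => (h x hx y hxy).1) hx hab) _ hbc).2 ih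

/-- If any discrepancy between two edge sets with equal outdegrees can be diminished by a shift in
one of the two, then the steps connect all the edge sets. -/
theorem reflTransGen_of_shift {Step : Finset (V × V) → Finset (V × V) → Prop}
    {S : Set (Finset (V × V))} (hstep : ∀ E ∈ S, ∀ F, Step E F → F ∈ S ∧ Step F E)
    (hout : ∀ E ∈ S, ∀ F ∈ S, ∀ x, (outSet E x).card = (outSet F x).card)
    (hshift : ∀ A : Finset V, ∀ v ∈ A, ∀ E ∈ S, ∀ F ∈ S,
      (∀ x ∉ A, ∀ y, (x, y) ∈ E ↔ (x, y) ∈ F) → ∀ a b,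
      (v, a) ∈ E → (v, a) ∉ F → (v, b) ∉ E → (v, b) ∈ F →
      (∃ E', Shift Step A v a b E E') ∨ ∃ F', Shift Step A v b a F F')
    {E F : Finset (V × V)} (hE : E ∈ S) (hF : F ∈ S) : Relation.ReflTransGen Step E F := by
  have hmem {E E' : Finset (V × V)} (hE : E ∈ S) (h : Relation.ReflTransGen Step E E') : E' ∈ S :=
    mem_of_reflTransGen (fun x hx y hxy => (hstep x hx y hxy).1) hE h
  suffices key : ∀ A : Finset V, ∀ E ∈ S, ∀ F ∈ S, (∀ x ∉ A, ∀ y, (x, y) ∈ E ↔ (x, y) ∈ F) →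
      Relation.ReflTransGen Step E F from
    key Finset.univ E hE F hF fun x hx => (hx (Finset.mem_univ x)).elim
  intro A
  induction A using Finset.induction_on with
  | empty =>
    intro E _ F _ h
    have : E = F := by
      ext ⟨x, y⟩
      exact h x (Finset.notMem_empty x) y
    rw [this]
  | insert v A _ ihA =>
    -- Row v is repaired first, by induction on the number n of its surplus out-neighbours;
    -- afterwards only rows in A may differ.
    have inner : ∀ n, ∀ E ∈ S, ∀ F ∈ S, (outSet E v \ outSet F v).card = n →
        (∀ x ∉ insert v A, ∀ y, (x, y) ∈ E ↔ (x, y) ∈ F) → Relation.ReflTransGen Step E F := by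
      intro n
      induction n with
      | zero =>
        intro E hE F hF h0 h
        have hsub : outSet E v ⊆ outSet F v := Finset.sdiff_eq_empty_iff_subset.1
          (Finset.card_eq_zero.1 h0)
        have heq := Finset.eq_of_subset_of_card_le hsub (hout E hE F hF v).ge
        refine ihA E hE F hF fun x hx y => ?_
        by_cases hxv : x = v
        · rw [hxv, ← mem_outSet, ← mem_outSet, heq]
        · exact h x (by simp [hxv, hx]) y
      | succ n ih =>
        intro E hE F hF hn h
        obtain ⟨a, ha⟩ : (outSet E v \ outSet F v).Nonempty := by
          rw [← Finset.card_pos]; omega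
        -- Equal outdegrees match each surplus of E at v with one of F.
        obtain ⟨b, hb⟩ : (outSet F v \ outSet E v).Nonempty := by
          rw [← Finset.card_pos, ← Finset.card_sdiff_comm (hout E hE F hF v)]; omega
        have hcard : ((outSet E v \ outSet F v).erase a).card = n := by
          rw [Finset.card_erase_of_mem ha]; omega
        simp only [Finset.mem_sdiff, mem_outSet] at ha hb
        rcases hshift _ v (Finset.mem_insert_self v A) E hE F hF h a b ha.1 ha.2 hb.2 hb.1 with
          ⟨E', hEE', hrows, hrow⟩ | ⟨F', hFF', hrows, hrow⟩
        · refine hEE'.trans (ih E' (hmem hE hEE') F hF ?_ fun x hx y =>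
            (hrows x hx y).trans (h x hx y))
          rw [← hcard]
          congr 1
          ext y
          simp only [Finset.mem_sdiff, Finset.mem_erase, mem_outSet, hrow]
          by_cases hyb : y = b
          · subst hyb; tauto
          · tauto
        -- A shift of F gives a path starting at F, which is run backwards.
        · refine (ih E hE F' (hmem hF hFF') ?_ fun x hx y =>
            (h x hx y).trans (hrows x hx y).symm).trans (reflTransGen_symm_on hstep hF hFF')
          rw [← hcard]
          congr 1
          ext y
          simp only [Finset.mem_sdiff, Finset.mem_erase, mem_outSet, hrow]
          by_cases hyb : y = b
          · subst hyb; tauto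
          · tauto
    exact fun E hE F hF h => inner _ E hE F hF rfl h

/-- Sources outside A contribute equally to the two indegrees of y, so those in A do too. -/
theorem card_inter_inSet_eq {E F : Finset (V × V)} (h : SameDegrees E F) {A : Finset V}
    (hA : ∀ x ∉ A, ∀ y, (x, y) ∈ E ↔ (x, y) ∈ F) (y : V) :
    (inSet E y ∩ A).card = (inSet F y ∩ A).card := by
  have h1 := (sameDegrees_iff.1 h).2 y
  have h2 : inSet E y \ A = inSet F y \ A := by
    ext x
    simp only [Finset.mem_sdiff, mem_inSet]
    by_cases hx : x ∈ A
    · simp [hx]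
    · simp [hx, hA x hx y]
  rw [← Finset.card_inter_add_card_sdiff (inSet E y) A,
    ← Finset.card_inter_add_card_sdiff (inSet F y) A, h2] at h1
  omega

end EdgeSets

/-! ### Switches and triangle reversals of directed edge sets -/

section DirectedEdgeSets

variable {V : Type*}

def DiSwitch (E F : Finset (V × V)) : Prop :=
  ∃ x y z w, (x ≠ y ∧ x ≠ z ∧ x ≠ w ∧ y ≠ z ∧ y ≠ w ∧ z ≠ w) ∧
    ((x, y) ∈ E ∧ (z, w) ∈ E ∧ (x, w) ∉ E ∧ (z, y) ∉ E) ∧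
    F = replaceEdges E {(x, y), (z, w)} {(x, w), (z, y)}

def DiReversal (E F : Finset (V × V)) : Prop :=
  ∃ x y z, ((x, y) ∈ E ∧ (y, z) ∈ E ∧ (z, x) ∈ E) ∧ ((y, x) ∉ E ∧ (z, y) ∉ E ∧ (x, z) ∉ E) ∧
    F = replaceEdges E {(x, y), (y, z), (z, x)} {(y, x), (z, y), (x, z)}

def DiStep (E F : Finset (V × V)) : Prop := DiSwitch E F ∨ DiReversal E F

def Loopless (E : Finset (V × V)) : Prop := ∀ x, (x, x) ∉ E

theorem DiSwitch.symm {E F : Finset (V × V)} (h : DiSwitch E F) : DiSwitch F E := by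
  obtain ⟨x, y, z, w, hd, ⟨h1, h2, h3, h4⟩, rfl⟩ := h
  refine ⟨x, w, z, y, by grind, ?_, ?_⟩
  · simp only [mem_replaceEdges]
    grind
  · rw [replaceEdges_replaceEdges]
    · grind
    · rw [Finset.disjoint_left]; grind

theorem DiReversal.symm {E F : Finset (V × V)} (h : DiReversal E F) : DiReversal F E := by
  obtain ⟨x, y, z, ⟨h1, h2, h3⟩, ⟨h4, h5, h6⟩, rfl⟩ := h
  have hxy : x ≠ y := by rintro rfl; exact h4 h1
  have hyz : y ≠ z := by rintro rfl; exact h5 h2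
  have hzx : z ≠ x := by rintro rfl; exact h6 h3
  -- The reversed cycle is y → x → z → y, hence the exchange of the first two nodes.
  refine ⟨y, x, z, ?_, ?_, ?_⟩
  · simp [mem_replaceEdges]
  · simp [mem_replaceEdges, hxy, hyz, hzx, hxy.symm, hyz.symm, hzx.symm]
  · have e1 : ({(y, x), (x, z), (z, y)} : Finset (V × V)) = {(y, x), (z, y), (x, z)} := by grind
    have e2 : ({(x, y), (z, x), (y, z)} : Finset (V × V)) = {(x, y), (y, z), (z, x)} := by grind
    rw [e1, e2, replaceEdges_replaceEdges]
    · grind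
    · rw [Finset.disjoint_left]; grind

theorem sameDegrees_pair {x y z w : V} (hxz : x ≠ z) :
    SameDegrees ({(x, w), (z, y)} : Finset (V × V)) {(x, y), (z, w)} := by
  have h1 (s t : V) : ({(x, s), (z, t)} : Finset (V × V)).val = {(x, s), (z, t)} := by
    rw [Finset.insert_val_of_notMem (by simp [hxz])]
    rfl
  constructor
  · simp [h1]
  · simp only [h1]
    exact Multiset.cons_swap w y 0

theorem DiSwitch.sameDegrees {E F : Finset (V × V)} (h : DiSwitch E F) : SameDegrees F E := by
  obtain ⟨x, y, z, w, hd, ⟨h1, h2, h3, h4⟩, rfl⟩ := h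
  refine sameDegrees_replaceEdges (by grind) ?_ (sameDegrees_pair hd.2.1)
  rw [Finset.disjoint_left]; grind

theorem DiReversal.sameDegrees {E F : Finset (V × V)} (h : DiReversal E F) : SameDegrees F E := by
  obtain ⟨x, y, z, ⟨h1, h2, h3⟩, ⟨h4, h5, h6⟩, rfl⟩ := h
  have hxy : x ≠ y := by rintro rfl; exact h4 h1
  have hyz : y ≠ z := by rintro rfl; exact h5 h2
  have hzx : z ≠ x := by rintro rfl; exact h6 h3
  refine sameDegrees_replaceEdges (by grind) ?_ ?_
  · rw [Finset.disjoint_left]; grind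
  · have e1 : ({(y, x), (z, y), (x, z)} : Finset (V × V)).val = {(y, x), (z, y), (x, z)} := by
      rw [Finset.insert_val_of_notMem (by simp; grind),
        Finset.insert_val_of_notMem (by simp; grind)]
      rfl
    have e2 : ({(x, y), (y, z), (z, x)} : Finset (V × V)).val = {(x, y), (y, z), (z, x)} := by
      rw [Finset.insert_val_of_notMem (by simp; grind),
        Finset.insert_val_of_notMem (by simp; grind)]
      rfl
    constructor
    · rw [e1, e2]
      ext u
      simp [Multiset.count_cons, Multiset.count_singleton]
      omega
    · rw [e1, e2]
      ext u
      simp [Multiset.count_cons, Multiset.count_singleton]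
      omega

theorem DiStep.symm {E F : Finset (V × V)} (h : DiStep E F) : DiStep F E :=
  h.imp DiSwitch.symm DiReversal.symm

theorem DiStep.sameDegrees {E F : Finset (V × V)} (h : DiStep E F) : SameDegrees F E :=
  h.elim DiSwitch.sameDegrees DiReversal.sameDegrees

theorem DiStep.loopless {E F : Finset (V × V)} (h : DiStep E F) (hE : Loopless E) :
    Loopless F := by
  intro u
  have hu := hE u
  rcases h with ⟨x, y, z, w, hd, h1, rfl⟩ | ⟨x, y, z, h1, h2, rfl⟩ <;>
  · rw [mem_replaceEdges]
    grind

end DirectedEdgeSets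

/-! ### Connectivity of digraphs with given degrees -/

section DirectedConnectivity

variable {V : Type*}

theorem shift_of_diSwitch {E : Finset (V × V)} (hE : Loopless E) {A : Finset V} {v w a b : V}
    (hv : v ∈ A) (hw : w ∈ A) (hva : (v, a) ∈ E) (hvb : (v, b) ∉ E) (hwb : (w, b) ∈ E)
    (hwa : (w, a) ∉ E) (hwne : w ≠ a) (hvne : v ≠ b) :
    Shift DiStep A v a b E (replaceEdges E {(v, a), (w, b)} {(v, b), (w, a)}) := by
  have hvw : v ≠ w := by rintro rfl; exact hvb hwb
  have hab : a ≠ b := by rintro rfl; exact hvb hva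
  have hav : a ≠ v := by rintro rfl; exact hE _ hva
  have hbw : b ≠ w := by rintro rfl; exact hE _ hwb
  refine ⟨.single (Or.inl ⟨v, a, w, b, by grind, ⟨hva, hwb, hvb, hwa⟩, rfl⟩), ?_, ?_⟩
  · intro x hx y
    have h1 : x ≠ v := by rintro rfl; exact hx hv
    have h2 : x ≠ w := by rintro rfl; exact hx hw
    simp [mem_replaceEdges, h1, h2]
  · intro y
    simp [mem_replaceEdges, hvw]

theorem exists_shift_of_diReversal {E : Finset (V × V)} {A : Finset V}
    {v a b : V} (hv : v ∈ A) (ha : a ∈ A) (hb : b ∈ A) (hva : (v, a) ∈ E) (hab : (a, b) ∈ E)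
    (hbv : (b, v) ∈ E) (hav : (a, v) ∉ E) (hba : (b, a) ∉ E) (hvb : (v, b) ∉ E) :
    ∃ E', Shift DiStep A v a b E E' := by
  have h1 : v ≠ a := by rintro rfl; exact hav hva
  have h2 : a ≠ b := by rintro rfl; exact hba hab
  have h3 : b ≠ v := by rintro rfl; exact hvb hbv
  refine ⟨_, .single (Or.inr ⟨v, a, b, ⟨hva, hab, hbv⟩, ⟨hav, hba, hvb⟩, rfl⟩), ?_, ?_⟩
  · intro x hx y
    have h4 : x ≠ v := by rintro rfl; exact hx hv
    have h5 : x ≠ a := by rintro rfl; exact hx ha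
    have h6 : x ≠ b := by rintro rfl; exact hx hb
    simp [mem_replaceEdges, h4, h5, h6]
  · intro y
    simp [mem_replaceEdges, h1, h3.symm]

/-- The net effect trades va, ab, bx for vb, ax, ba. The edge vx is used and restored if present,
created and removed if absent; this decides the order of the two switches. -/
theorem exists_shift_of_two_diSwitch {E : Finset (V × V)} (hE : Loopless E) {A : Finset V}
    {v a b x : V} (hv : v ∈ A) (ha : a ∈ A) (hb : b ∈ A) (hva : (v, a) ∈ E) (hab : (a, b) ∈ E)
    (hba : (b, a) ∉ E) (hvb : (v, b) ∉ E) (hvneb : v ≠ b) (hbx : (b, x) ∈ E) (hax : (a, x) ∉ E)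
    (hxv : x ≠ v) :
    ∃ E', Shift DiStep A v a b E E' := by
  have h1 : v ≠ a := by rintro rfl; exact hE _ hva
  have h2 : a ≠ b := by rintro rfl; exact hE _ hab
  have h4 : x ≠ b := by rintro rfl; exact hE _ hbx
  have h5 : x ≠ a := by rintro rfl; exact hba hbx
  by_cases hvx : (v, x) ∈ E
  · set E₁ := replaceEdges E {(v, x), (a, b)} {(v, b), (a, x)} with hE₁
    have s1 : DiStep E E₁ := Or.inl ⟨v, x, a, b, by grind, ⟨hvx, hab, hvb, hax⟩, rfl⟩
    have s2 : DiStep E₁ (replaceEdges E₁ {(v, a), (b, x)} {(v, x), (b, a)}) := by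
      refine Or.inl ⟨v, a, b, x, by grind, ?_, rfl⟩
      simp [mem_replaceEdges, *, h2.symm, h5.symm, hvneb.symm]
    refine ⟨_, .tail (.single s1) s2, ?_, ?_⟩
    · intro z hz y
      have h6 : z ≠ v := by rintro rfl; exact hz hv
      have h7 : z ≠ a := by rintro rfl; exact hz ha
      have h8 : z ≠ b := by rintro rfl; exact hz hb
      simp [hE₁, mem_replaceEdges, h6, h7, h8]
    · intro y
      simp only [hE₁, mem_replaceEdges, Finset.mem_insert, Finset.mem_singleton, Prod.mk.injEq]
      grind
  · set E₁ := replaceEdges E {(v, a), (b, x)} {(v, x), (b, a)} with hE₁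
    have s1 : DiStep E E₁ := Or.inl ⟨v, a, b, x, by grind, ⟨hva, hbx, hvx, hba⟩, rfl⟩
    have s2 : DiStep E₁ (replaceEdges E₁ {(v, x), (a, b)} {(v, b), (a, x)}) := by
      refine Or.inl ⟨v, x, a, b, by grind, ?_, rfl⟩
      simp [mem_replaceEdges, *, h1.symm, h2.symm, h4.symm]
    refine ⟨_, .tail (.single s1) s2, ?_, ?_⟩
    · intro z hz y
      have h6 : z ≠ v := by rintro rfl; exact hz hv
      have h7 : z ≠ a := by rintro rfl; exact hz ha
      have h8 : z ≠ b := by rintro rfl; exact hz hb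
      simp [hE₁, mem_replaceEdges, h6, h7, h8]
    · intro y
      simp only [hE₁, mem_replaceEdges, Finset.mem_insert, Finset.mem_singleton, Prod.mk.injEq]
      grind

variable [Fintype V]

/-- Either a switch shifts the edge `va` to `vb`, or the edge `ab` is in the way. -/
theorem exists_shift_or_mem {E : Finset (V × V)} (hE : Loopless E) {A : Finset V} {v a b : V}
    (hv : v ∈ A) (hva : (v, a) ∈ E) (hvb : (v, b) ∉ E) (hvne : v ≠ b)
    (hcard : (inSet E a ∩ A).card ≤ (inSet E b ∩ A).card) :
    (∃ E', Shift DiStep A v a b E E') ∨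
      a ∈ A ∧ (a, b) ∈ E ∧ (b ∈ A → (b, a) ∉ E) ∧
        (inSet E b ∩ A).card ≤ (inSet E a ∩ A).card := by
  set I := inSet E a ∩ A with hI
  set J := inSet E b ∩ A with hJ
  have hmI (x : V) : x ∈ I ↔ (x, a) ∈ E ∧ x ∈ A := by simp [hI]
  have hmJ (x : V) : x ∈ J ↔ (x, b) ∈ E ∧ x ∈ A := by simp [hJ]
  have h1 := Finset.card_inter_add_card_sdiff I J
  have h2 := Finset.card_inter_add_card_sdiff J I
  rw [Finset.inter_comm J I] at h2
  have hvIJ : v ∈ I \ J := by simp [hmI, hmJ, hva, hvb, hv]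
  have hpos : 0 < (I \ J).card := Finset.card_pos.2 ⟨v, hvIJ⟩
  by_cases hw : ∃ w ∈ J \ I, w ≠ a
  · obtain ⟨w, hw, hwa⟩ := hw
    rw [Finset.mem_sdiff, hmI, hmJ] at hw
    exact Or.inl ⟨_, shift_of_diSwitch hE hv hw.1.2 hva hvb hw.1.1 (fun h => hw.2 ⟨h, hw.1.2⟩)
      hwa hvne⟩
  -- Here J \ I can contain only a. Since 0 < |I \ J| ≤ |J \ I| ≤ 1, the differences are the
  -- singletons {v} and {a}, which yields ab ∈ E, excludes ba if b ∈ A, and makes |I| = |J|.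
  · push Not at hw
    have hsub : J \ I ⊆ {a} := fun w h => Finset.mem_singleton.2 (hw w h)
    have hle : (J \ I).card ≤ 1 := (Finset.card_le_card hsub).trans (by simp)
    obtain ⟨w, hwJ⟩ : (J \ I).Nonempty := Finset.card_pos.1 (by omega)
    obtain rfl := hw w hwJ
    rw [Finset.mem_sdiff, hmI, hmJ] at hwJ
    refine Or.inr ⟨hwJ.1.2, hwJ.1.1, fun hb hba => ?_, by omega⟩
    have hbIJ : b ∈ I \ J := by simp [hmI, hmJ, hba, hb, hE b]
    have := Finset.card_le_one.1 (by omega : (I \ J).card ≤ 1) v hvIJ b hbIJ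
    exact hvne this

/-- As b is an out-neighbour of a but not of itself, the outdegrees provide x with bx ∈ E and ax ∉
E. If x = v, the triangle v → a → b → v can be reversed; otherwise two switches suffice. -/
theorem exists_shift_of_card_le {E : Finset (V × V)} (hE : Loopless E) {A : Finset V} {v a b : V}
    (hv : v ∈ A) (ha : a ∈ A) (hb : b ∈ A) (hva : (v, a) ∈ E) (hvb : (v, b) ∉ E)
    (hab : (a, b) ∈ E) (hba : (b, a) ∉ E) (hvneb : v ≠ b)
    (hcard : (outSet E a).card ≤ (outSet E b).card) :
    ∃ E', Shift DiStep A v a b E E' := by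
  have hnsub : ¬ outSet E b ⊆ outSet E a := by
    intro hsub
    have := Finset.eq_of_subset_of_card_le hsub hcard
    have hb' : b ∈ outSet E a := by simpa using hab
    rw [← this, mem_outSet] at hb'
    exact hE b hb'
  obtain ⟨x, hx, hx'⟩ := Finset.not_subset.1 hnsub
  rw [mem_outSet] at hx hx'
  by_cases hxv : x = v
  · subst hxv
    exact exists_shift_of_diReversal hv ha hb hva hab hx hx' hba hvb
  · exact exists_shift_of_two_diSwitch hE hv ha hb hva hab hba hvb hvneb hx hx' hxv

/-- If no switch of E works, the edge ab is in the way and the indegrees from A are equal, so the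
argument can be repeated for F with a and b exchanged. If it fails there too, comparing the
outdegrees of a and b, which E and F share, tells which of the two sets can be shifted. -/
theorem exists_diShift {E F : Finset (V × V)} (hE : Loopless E) (hF : Loopless F)
    (h : SameDegrees E F) {A : Finset V} (hA : ∀ x ∉ A, ∀ y, (x, y) ∈ E ↔ (x, y) ∈ F) {v a b : V}
    (hv : v ∈ A) (hva : (v, a) ∈ E) (hva' : (v, a) ∉ F) (hvb : (v, b) ∉ E) (hvb' : (v, b) ∈ F)
    (hcard : (inSet E a ∩ A).card ≤ (inSet E b ∩ A).card) :
    (∃ E', Shift DiStep A v a b E E') ∨ ∃ F', Shift DiStep A v b a F F' := by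
  have hvneb : v ≠ b := by rintro rfl; exact hF _ hvb'
  have hvnea : v ≠ a := by rintro rfl; exact hE _ hva
  rcases exists_shift_or_mem hE hv hva hvb hvneb hcard with h1 | ⟨ha, hab, hba, hcard'⟩
  · exact Or.inl h1
  rw [card_inter_inSet_eq h hA, card_inter_inSet_eq h hA] at hcard'
  rcases exists_shift_or_mem hF hv hvb' hva' hvnea hcard' with h1 | ⟨hb, hba', hab', -⟩
  · exact Or.inr h1
  rcases le_total (outSet E a).card (outSet E b).card with hle | hle
  · exact Or.inl (exists_shift_of_card_le hE hv ha hb hva hvb hab (hba hb) hvneb hle)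
  · rw [(sameDegrees_iff.1 h).1, (sameDegrees_iff.1 h).1 a] at hle
    exact Or.inr (exists_shift_of_card_le hF hv hb ha hvb' hva' hba' (hab' ha) hvnea hle)

/-- Loopless digraphs with the same degrees are connected by switches and triangle reversals. -/
theorem reflTransGen_diStep {E F : Finset (V × V)} (hE : Loopless E) (hF : Loopless F)
    (h : SameDegrees E F) : Relation.ReflTransGen DiStep E F := by
  refine reflTransGen_of_shift (S := {H | Loopless H ∧ SameDegrees H E}) ?_ ?_ ?_
    ⟨hE, .refl E⟩ ⟨hF, h.symm⟩
  · exact fun H hH H' hstep => ⟨⟨hstep.loopless hH.1, hstep.sameDegrees.trans hH.2⟩, hstep.symm⟩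
  · exact fun H hH H' hH' => (sameDegrees_iff.1 (hH.2.trans hH'.2.symm)).1
  · intro A v hv H hH H' hH' hA a b h1 h2 h3 h4
    have hd : SameDegrees H H' := hH.2.trans hH'.2.symm
    rcases le_total (inSet H a ∩ A).card (inSet H b ∩ A).card with hle | hle
    · exact exists_diShift hH.1 hH'.1 hd hA hv h1 h2 h3 h4 hle
    · rw [card_inter_inSet_eq hd hA, card_inter_inSet_eq hd hA] at hle
      exact (exists_diShift hH'.1 hH.1 hd.symm (fun x hx y => (hA x hx y).symm) hv h4 h3 h2 h1
        hle).symm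

end DirectedConnectivity

/-! ### Connectivity of undirected graphs with given degrees -/

section UndirectedConnectivity

variable {V : Type*}

def SymmEdges (E : Finset (V × V)) : Prop := ∀ x y, (x, y) ∈ E → (y, x) ∈ E

/-- The switch of two edges in an undirected graph, each edge being represented by both of its
orientations. -/
def UnSwitch (E F : Finset (V × V)) : Prop :=
  ∃ x y z w, (x ≠ y ∧ x ≠ z ∧ x ≠ w ∧ y ≠ z ∧ y ≠ w ∧ z ≠ w) ∧
    ((x, y) ∈ E ∧ (z, w) ∈ E ∧ (x, w) ∉ E ∧ (z, y) ∉ E) ∧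
    F = replaceEdges E {(x, y), (y, x), (z, w), (w, z)} {(x, w), (w, x), (z, y), (y, z)}

theorem UnSwitch.symm {E F : Finset (V × V)} (hE : SymmEdges E) (h : UnSwitch E F) :
    UnSwitch F E := by
  obtain ⟨x, y, z, w, hd, ⟨h1, h2, h3, h4⟩, rfl⟩ := h
  have h5 := hE _ _ h1
  have h6 := hE _ _ h2
  have h7 : (w, x) ∉ E := fun h => h3 (hE _ _ h)
  have h8 : (y, z) ∉ E := fun h => h4 (hE _ _ h)
  refine ⟨x, w, z, y, by grind, ?_, ?_⟩
  · simp [mem_replaceEdges]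
    grind
  · rw [replaceEdges_replaceEdges]
    · simp [Finset.insert_subset_iff, *]
    · rw [Finset.disjoint_left]
      simp [*]

theorem UnSwitch.sameDegrees {E F : Finset (V × V)} (hE : SymmEdges E) (h : UnSwitch E F) :
    SameDegrees F E := by
  obtain ⟨x, y, z, w, hd, ⟨h1, h2, h3, h4⟩, rfl⟩ := h
  have h5 := hE _ _ h1
  have h6 := hE _ _ h2
  have h7 : (w, x) ∉ E := fun h => h3 (hE _ _ h)
  have h8 : (y, z) ∉ E := fun h => h4 (hE _ _ h)
  refine sameDegrees_replaceEdges (by simp [Finset.insert_subset_iff, *])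
    (by rw [Finset.disjoint_left]; simp [*]) ?_
  have key (s t : V) (h1 : x ≠ s) (h2 : x ≠ t) (h3 : z ≠ s) (h4 : z ≠ t) (h5 : x ≠ z)
      (h6 : s ≠ t) : ({(x, s), (s, x), (z, t), (t, z)} : Finset (V × V)).val =
        {(x, s), (s, x), (z, t), (t, z)} := by
    rw [Finset.insert_val_of_notMem (by simp; grind),
      Finset.insert_val_of_notMem (by simp; grind), Finset.insert_val_of_notMem (by simp; grind)]
    rfl
  constructor
  · rw [key w y (by grind) (by grind) (by grind) (by grind) (by grind) (by grind),
      key y w (by grind) (by grind) (by grind) (by grind) (by grind) (by grind)]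
    ext u
    simp [Multiset.count_cons, Multiset.count_singleton]
    omega
  · rw [key w y (by grind) (by grind) (by grind) (by grind) (by grind) (by grind),
      key y w (by grind) (by grind) (by grind) (by grind) (by grind) (by grind)]
    ext u
    simp [Multiset.count_cons, Multiset.count_singleton]
    omega

theorem UnSwitch.loopless {E F : Finset (V × V)} (h : UnSwitch E F) (hE : Loopless E) :
    Loopless F := by
  intro u
  obtain ⟨x, y, z, w, hd, -, rfl⟩ := h
  have hu := hE u
  simp only [mem_replaceEdges, Finset.mem_insert, Finset.mem_singleton, Prod.mk.injEq]
  grind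

theorem UnSwitch.symmEdges {E F : Finset (V × V)} (h : UnSwitch E F) (hE : SymmEdges E) :
    SymmEdges F := by
  intro u u'
  obtain ⟨x, y, z, w, hd, -, rfl⟩ := h
  have hu := hE u u'
  simp only [mem_replaceEdges, Finset.mem_insert, Finset.mem_singleton, Prod.mk.injEq]
  tauto

variable [Fintype V]

/-- Symmetry makes a single switch suffice: if ab is an edge, then a ∈ J and b ∈ I, and discarding
both preserves |I| ≤ |J|, so v ∈ I \ J still forces some w ≠ a in J \ I. -/
theorem exists_unShift {E : Finset (V × V)} (hE : Loopless E) (hs : SymmEdges E)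
    {A : Finset V} {v a b : V} (hv : v ∈ A) (ha : a ∈ A) (hb : b ∈ A) (hva : (v, a) ∈ E)
    (hvb : (v, b) ∉ E) (hvne : v ≠ b) (hcard : (inSet E a ∩ A).card ≤ (inSet E b ∩ A).card) :
    ∃ E', Shift UnSwitch A v a b E E' := by
  set I := inSet E a ∩ A with hI
  set J := inSet E b ∩ A with hJ
  have hmI (x : V) : x ∈ I ↔ (x, a) ∈ E ∧ x ∈ A := by simp [hI]
  have hmJ (x : V) : x ∈ J ↔ (x, b) ∈ E ∧ x ∈ A := by simp [hJ]
  have hvIJ : v ∈ I \ J := by simp [hmI, hmJ, hva, hvb, hv]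
  obtain ⟨w, hwb, hwa, hwne, hw⟩ : ∃ w, (w, b) ∈ E ∧ (w, a) ∉ E ∧ w ≠ a ∧ w ∈ A := by
    by_contra hcon
    push Not at hcon
    have hsub : J.erase a ⊆ (I.erase b).erase v := by
      intro w hw
      rw [Finset.mem_erase, hmJ] at hw
      rw [Finset.mem_erase, Finset.mem_erase, hmI]
      refine ⟨?_, ?_, ?_, hw.2.2⟩
      · rintro rfl; exact hvb hw.2.1
      · rintro rfl; exact hE _ hw.2.1
      · by_contra hwa
        exact hcon w hw.2.1 hwa hw.1 hw.2.2
    have hle := Finset.card_le_card hsub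
    have hvI : v ∈ I.erase b := Finset.mem_erase.2 ⟨hvne, (Finset.mem_sdiff.1 hvIJ).1⟩
    rw [Finset.card_erase_of_mem hvI] at hle
    have hpos : 0 < (I.erase b).card := Finset.card_pos.2 ⟨v, hvI⟩
    by_cases hab : (a, b) ∈ E
    · rw [Finset.card_erase_of_mem ((hmJ a).2 ⟨hab, ha⟩),
        Finset.card_erase_of_mem ((hmI b).2 ⟨hs _ _ hab, hb⟩)] at hle
      rw [Finset.card_erase_of_mem ((hmI b).2 ⟨hs _ _ hab, hb⟩)] at hpos
      omega
    · rw [Finset.erase_eq_of_notMem fun h => hab ((hmJ a).1 h).1,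
        Finset.erase_eq_of_notMem fun h => hab (hs _ _ ((hmI b).1 h).1)] at hle
      rw [Finset.erase_eq_of_notMem fun h => hab (hs _ _ ((hmI b).1 h).1)] at hpos
      omega
  have hvw : v ≠ w := by rintro rfl; exact hvb hwb
  have hab : a ≠ b := by rintro rfl; exact hvb hva
  have hav : a ≠ v := by rintro rfl; exact hE _ hva
  have hbw : b ≠ w := by rintro rfl; exact hE _ hwb
  refine ⟨_, .single ⟨v, a, w, b, by grind, ⟨hva, hwb, hvb, hwa⟩, rfl⟩, ?_, ?_⟩
  · intro x hx y
    have h1 : x ≠ v := by rintro rfl; exact hx hv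
    have h2 : x ≠ w := by rintro rfl; exact hx hw
    have h3 : x ≠ a := by rintro rfl; exact hx ha
    have h4 : x ≠ b := by rintro rfl; exact hx hb
    simp [mem_replaceEdges, h1, h2, h3, h4]
  · intro y
    simp [mem_replaceEdges, hvw, hav.symm, hvne]

/-- Graphs with the same degrees are connected by switches. -/
theorem reflTransGen_unSwitch {E F : Finset (V × V)} (hE : Loopless E) (hF : Loopless F)
    (hEs : SymmEdges E) (hFs : SymmEdges F)
    (h : SameDegrees E F) : Relation.ReflTransGen UnSwitch E F := by
  refine reflTransGen_of_shift (S := {H | (Loopless H ∧ SymmEdges H) ∧ SameDegrees H E}) ?_ ?_ ?_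
    ⟨⟨hE, hEs⟩, .refl E⟩ ⟨⟨hF, hFs⟩, h.symm⟩
  · exact fun H hH H' hstep => ⟨⟨⟨hstep.loopless hH.1.1, hstep.symmEdges hH.1.2⟩,
      (hstep.sameDegrees hH.1.2).trans hH.2⟩, hstep.symm hH.1.2⟩
  · exact fun H hH H' hH' => (sameDegrees_iff.1 (hH.2.trans hH'.2.symm)).1
  · intro A v hv H hH H' hH' hA a b h1 h2 h3 h4
    have hd : SameDegrees H H' := hH.2.trans hH'.2.symm
    -- If a were outside A, its row would be the same in both sets, and by symmetry so would the
    -- status of va.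
    have ha : a ∈ A := by
      by_contra ha
      exact h2 (hH'.1.2 _ _ ((hA a ha v).1 (hH.1.2 _ _ h1)))
    have hb : b ∈ A := by
      by_contra hb
      exact h3 (hH.1.2 _ _ ((hA b hb v).2 (hH'.1.2 _ _ h4)))
    rcases le_total (inSet H a ∩ A).card (inSet H b ∩ A).card with hle | hle
    · exact Or.inl (exists_unShift hH.1.1 hH.1.2 hv ha hb h1 h3
        (by rintro rfl; exact hH'.1.1 _ h4) hle)
    · rw [card_inter_inSet_eq hd hA, card_inter_inSet_eq hd hA] at hle
      exact Or.inr (exists_unShift hH'.1.1 hH'.1.2 hv hb ha h4 h2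
        (by rintro rfl; exact hH.1.1 _ h1) hle)

end UndirectedConnectivity

/-! ### Uniform draws and symmetry of the resulting kernels -/

section Draw

variable {α β : Type*}

theorem draw_apply {T : Finset β} (hT : T.Nonempty) (x : α) (k : β → PMF α) (y : α) :
    draw T x k y = (T.card : ℝ≥0∞)⁻¹ * ∑ t ∈ T, k t y := by
  rw [draw, dif_pos hT, PMF.bind_apply, tsum_eq_sum (s := T), Finset.mul_sum]
  · exact Finset.sum_congr rfl fun t ht => by rw [PMF.uniformOfFinset_apply_of_mem hT ht]
  · exact fun t ht => by rw [PMF.uniformOfFinset_apply_of_notMem hT ht, zero_mul]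

theorem draw_ne_zero_iff {T : Finset β} (hT : T.Nonempty) {x : α} {k : β → PMF α} {y : α} :
    draw T x k y ≠ 0 ↔ ∃ t ∈ T, k t y ≠ 0 := by
  rw [draw_apply hT, mul_ne_zero_iff, ne_eq (∑ t ∈ T, k t y), Finset.sum_eq_zero_iff]
  simp

theorem pure_ne_zero_iff {x y : α} : PMF.pure x y ≠ 0 ↔ x = y := by
  rw [PMF.pure_apply]
  simp [eq_comm]

theorem draw_bind {T : Finset β} (hT : T.Nonempty) (x : α) (k : β → PMF α) (κ : α → PMF α) :
    (draw T x k).bind κ = draw T x fun t => (k t).bind κ := by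
  rw [draw, draw, dif_pos hT, dif_pos hT, PMF.bind_bind]

theorem draw_pair_apply {T : Finset β} (hT : T.Nonempty) (x : α) (g : β → β → α) (y : α) :
    (draw T x fun a => draw T x fun b => PMF.pure (g a b)) y =
      (T.card : ℝ≥0∞)⁻¹ * ((T.card : ℝ≥0∞)⁻¹ *
        ((T ×ˢ T).filter fun e => g e.1 e.2 = y).card) := by
  simp only [draw_apply hT, PMF.pure_apply, ← Finset.mul_sum]
  rw [← Finset.sum_product', Finset.card_filter]
  push_cast
  simp only [eq_comm]

theorem draw_triple_apply {T : Finset β} (hT : T.Nonempty) (x : α) (g : β → β → β → α) (y : α) :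
    (draw T x fun a => draw T x fun b => draw T x fun c => PMF.pure (g a b c)) y =
      (T.card : ℝ≥0∞)⁻¹ * ((T.card : ℝ≥0∞)⁻¹ * ((T.card : ℝ≥0∞)⁻¹ *
        ((T ×ˢ (T ×ˢ T)).filter fun e => g e.1 e.2.1 e.2.2 = y).card)) := by
  simp only [draw_apply hT, PMF.pure_apply, ← Finset.mul_sum]
  rw [Finset.card_filter, Finset.sum_product]
  simp only [Finset.sum_product]
  push_cast
  simp only [eq_comm]

/-- If every move of a random pair can be undone by a pair that determines the given one, then the
transition probabilities are symmetric. -/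
theorem draw_pair_symm {T : α → Finset β} {f : β → β → α → α} {σ : β × β → β × β}
    (hσ : Function.Injective σ) {x y : α} (hT : (T x).Nonempty) (hcard : (T x).card = (T y).card)
    (hxy : ∀ e : β × β, e.1 ∈ T x → e.2 ∈ T x → f e.1 e.2 x = y →
      (σ e).1 ∈ T y ∧ (σ e).2 ∈ T y ∧ f (σ e).1 (σ e).2 y = x)
    (hyx : ∀ e : β × β, e.1 ∈ T y → e.2 ∈ T y → f e.1 e.2 y = x →
      (σ e).1 ∈ T x ∧ (σ e).2 ∈ T x ∧ f (σ e).1 (σ e).2 x = y) :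
    (draw (T x) x fun a => draw (T x) x fun b => PMF.pure (f a b x)) y =
      (draw (T y) y fun a => draw (T y) y fun b => PMF.pure (f a b y)) x := by
  have hT' : (T y).Nonempty := by rwa [← Finset.card_pos, ← hcard, Finset.card_pos]
  rw [draw_pair_apply hT, draw_pair_apply hT', hcard]
  congr 3
  -- `σ` injects the pairs leading from x to y into those leading back, and conversely, so the
  -- counts agree.
  refine le_antisymm (Finset.card_le_card_of_injOn σ (fun e he => ?_) hσ.injOn)
    (Finset.card_le_card_of_injOn σ (fun e he => ?_) hσ.injOn)
  all_goals
    simp only [Finset.coe_filter, Set.mem_ofPred_eq, Finset.mem_product] at he ⊢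
  · have := hxy e he.1.1 he.1.2 he.2
    exact ⟨⟨this.1, this.2.1⟩, this.2.2⟩
  · have := hyx e he.1.1 he.1.2 he.2
    exact ⟨⟨this.1, this.2.1⟩, this.2.2⟩

theorem draw_triple_symm {T : Finset β} (hT : T.Nonempty) {f : β → β → β → α → α} {x y : α}
    (hxy : ∀ a b c, f a b c x = y → f b a c y = x) (hyx : ∀ a b c, f a b c y = x → f b a c x = y) :
    (draw T x fun a => draw T x fun b => draw T x fun c => PMF.pure (f a b c x)) y =
      (draw T y fun a => draw T y fun b => draw T y fun c => PMF.pure (f a b c y)) x := by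
  rw [draw_triple_apply hT, draw_triple_apply hT]
  congr 4
  let σ : β × β × β → β × β × β := fun e => (e.2.1, e.1, e.2.2)
  have hσ : Function.Injective σ := fun e e' h => by
    simp only [σ, Prod.mk.injEq] at h
    exact Prod.ext h.2.1 (Prod.ext h.1 h.2.2)
  refine le_antisymm (Finset.card_le_card_of_injOn σ (fun e he => ?_) hσ.injOn)
    (Finset.card_le_card_of_injOn σ (fun e he => ?_) hσ.injOn)
  all_goals
    simp only [Finset.coe_filter, Set.mem_ofPred_eq, Finset.mem_product, σ] at he ⊢
  · exact ⟨⟨he.1.2.1, he.1.1, he.1.2.2⟩, hxy _ _ _ he.2⟩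
  · exact ⟨⟨he.1.2.1, he.1.1, he.1.2.2⟩, hyx _ _ _ he.2⟩

/-- Lifts a path of edge sets to a path of graphs, with S recording what stays fixed along it. -/
theorem exists_reflTransGen_lift {Step : β → β → Prop} {R : α → α → Prop} {S : Set α} {f : α → β}
    (h : ∀ x ∈ S, ∀ b, Step (f x) b → ∃ y ∈ S, R x y ∧ f y = b) {x : α} (hx : x ∈ S) {b : β}
    (hb : Relation.ReflTransGen Step (f x) b) :
    ∃ y ∈ S, Relation.ReflTransGen R x y ∧ f y = b := by
  induction hb with
  | refl => exact ⟨x, hx, .refl, rfl⟩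
  | tail _ hbc ih =>
    obtain ⟨y, hy, hxy, rfl⟩ := ih
    obtain ⟨z, hz, hyz, rfl⟩ := h y hy _ hbc
    exact ⟨z, hz, hxy.tail hyz, rfl⟩

theorem distinct_of_card_eq_four {a b c d : α} (h : ({a, b, c, d} : Finset α).card = 4) :
    a ≠ b ∧ a ≠ c ∧ a ≠ d ∧ b ≠ c ∧ b ≠ d ∧ c ≠ d := by
  have h3 (x y z : α) : ({x, y, z} : Finset α).card ≤ 3 := Finset.card_le_three
  refine ⟨?_, ?_, ?_, ?_, ?_, ?_⟩ <;> rintro rfl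
  · have := h3 a c d; simp at h; omega
  · have := h3 a b d
    rw [Finset.insert_eq_of_mem (by simp)] at h
    have := h3 b a d; omega
  · rw [Finset.insert_eq_of_mem (by simp)] at h
    have := h3 b c a; omega
  · rw [Finset.insert_eq_of_mem (s := {b, d}) (by simp)] at h
    have := h3 a b d; omega
  · rw [Finset.insert_eq_of_mem (s := {c, b}) (by simp)] at h
    have := h3 a c b; omega
  · rw [Finset.insert_eq_of_mem (s := {c}) (by simp)] at h
    have := h3 a b c; omega

theorem card_eq_four_of_distinct {a b c d : α}
    (h : a ≠ b ∧ a ≠ c ∧ a ≠ d ∧ b ≠ c ∧ b ≠ d ∧ c ≠ d) : ({a, b, c, d} : Finset α).card = 4 := by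
  obtain ⟨h1, h2, h3, h4, h5, h6⟩ := h
  rw [Finset.card_insert_of_notMem (by simp [*]), Finset.card_insert_of_notMem (by simp [*]),
    Finset.card_pair h6]

/-- A coarser colouring is a function of the finer one. It is applied with the colouring of an
earlier round as g. -/
theorem map_eq_of_factorsThrough {V K : Type*} {g c : V → K} (h : Function.FactorsThrough g c)
    {s t : Multiset V} (hst : s.map c = t.map c) : s.map g = t.map g := by
  obtain hV | ⟨⟨v⟩⟩ := isEmpty_or_nonempty V
  · rw [Subsingleton.elim s t]
  · have : Nonempty K := ⟨c v⟩
    obtain ⟨φ, rfl⟩ := (Function.factorsThrough_iff g).1 h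
    rw [← Multiset.map_map, hst, Multiset.map_map]

end Draw

/-! ### Colour refinement in terms of degrees between classes -/

section Refinement

variable {V K : Type*} [Fintype V]

@[simp] theorem mem_pairEdges {adj : V → V → Prop} {c : V → K} {p : K × K} {e : V × V} :
    e ∈ pairEdges adj c p ↔ adj e.1 e.2 ∧ (c e.1, c e.2) = p := by
  simp [pairEdges, Prod.ext_iff]

theorem adj_iff_mem_pairEdges {adj : V → V → Prop} (c : V → K) {u v : V} :
    adj u v ↔ (u, v) ∈ pairEdges adj c (c u, c v) := by
  simp

/-- The multiplicity of colour j among the neighbours of v is the outdegree of v in the block (c v,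
j). In blocks whose first colour is not that of x, the outdegree of x is 0 anyway. -/
theorem map_neighbours_eq_iff {adj adj' : V → V → Prop} {c : V → K} :
    (∀ v, (Finset.univ.filter fun x => adj v x).val.map c =
      (Finset.univ.filter fun x => adj' v x).val.map c) ↔
    ∀ q x, (outSet (pairEdges adj c q) x).card = (outSet (pairEdges adj' c q) x).card := by
  have hcount (a : V → V → Prop) (v : V) (j : K) :
      ((Finset.univ.filter fun x => a v x).val.map c).count j =
        (outSet (pairEdges a c (c v, j)) v).card := by
    rw [Multiset.count_map, ← Finset.filter_val]
    change Finset.card _ = Finset.card _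
    congr 1
    ext x
    simp [eq_comm]
  constructor
  · rintro h ⟨i, j⟩ x
    by_cases hx : c x = i
    · subst hx
      rw [← hcount, ← hcount, h]
    · have hempty (a : V → V → Prop) : outSet (pairEdges a c (i, j)) x = ∅ := by
        ext y
        simp [hx]
      rw [hempty, hempty]
  · intro h v
    ext j
    rw [hcount, hcount, h]

theorem map_inNeighbours_eq_iff {adj adj' : V → V → Prop} {c : V → K} :
    (∀ v, (Finset.univ.filter fun x => adj x v).val.map c =
      (Finset.univ.filter fun x => adj' x v).val.map c) ↔
    ∀ q y, (inSet (pairEdges adj c q) y).card = (inSet (pairEdges adj' c q) y).card := by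
  have hflip (a : V → V → Prop) (q : K × K) (y : V) :
      inSet (pairEdges a c q) y = outSet (pairEdges (flip a) c q.swap) y := by
    ext x
    simp [flip, Prod.ext_iff, and_comm]
  refine (map_neighbours_eq_iff (adj := flip adj) (adj' := flip adj')).trans ?_
  simp only [hflip]
  exact ⟨fun h q => h q.swap, fun h q => by simpa using h q.swap⟩

/-- The hash retains the old colour, so the classes only get finer. -/
theorem refine_eq_of_le {hash : K × Multiset K → K} (hinj : Function.Injective hash) (c₀ : V → K)
    (G : SimpleGraph V) {s t : ℕ} (hst : s ≤ t) {u v : V}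
    (h : refine hash c₀ G t u = refine hash c₀ G t v) :
    refine hash c₀ G s u = refine hash c₀ G s v := by
  induction t, hst using Nat.le_induction with
  | base => exact h
  | succ t _ ih => exact ih (congrArg Prod.fst (hinj h))

theorem refineBoth_eq_of_le {hash : K × Multiset K × Multiset K → K}
    (hinj : Function.Injective hash) (c₀ : V → K)
    (G : Digraph V) {s t : ℕ} (hst : s ≤ t) {u v : V}
    (h : refineBoth hash c₀ G t u = refineBoth hash c₀ G t v) :
    refineBoth hash c₀ G s u = refineBoth hash c₀ G s v := by
  induction t, hst using Nat.le_induction with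
  | base => exact h
  | succ t _ ih => exact ih (congrArg Prod.fst (hinj h))

/-- The graphs with the same colours after `t + 1` rounds are those with the same degrees between
the colour classes of round `t`. -/
theorem nest_succ_eq {hash : K × Multiset K → K} (hinj : Function.Injective hash) (c₀ : V → K)
    (t : ℕ) (G : SimpleGraph V) :
    nest hash c₀ (t + 1) G = {H | ∀ q, SameDegrees (pairEdges H.Adj (refine hash c₀ G t) q)
      (pairEdges G.Adj (refine hash c₀ G t) q)} := by
  set c := refine hash c₀ G t with hc
  ext H
  have hdeg : (∀ q, SameDegrees (pairEdges H.Adj c q) (pairEdges G.Adj c q)) ↔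
      ∀ v, (Finset.univ.filter fun x => H.Adj v x).val.map c =
        (Finset.univ.filter fun x => G.Adj v x).val.map c := by
    constructor
    · exact fun h => map_neighbours_eq_iff.2 fun q => (sameDegrees_iff.1 (h q)).1
    · intro h q
      refine sameDegrees_iff.2 ⟨map_neighbours_eq_iff.1 h q, map_inNeighbours_eq_iff.1 ?_ q⟩
      simpa only [SimpleGraph.adj_comm] using h
  rw [Set.mem_ofPred_eq, hdeg]
  constructor
  · intro h v
    have h1 (u : V) := Prod.mk.inj (hinj (congrFun h u))
    have h2 : refine hash c₀ H t = c := funext fun u => (h1 u).1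
    have h3 := (h1 v).2
    rwa [h2] at h3
  · intro h
    -- Equality passes from round s to s + 1 ≤ t + 1: the colours of round s are a function of those
    -- of round t, for which the neighbour multisets agree.
    suffices key : ∀ s ≤ t + 1, refine hash c₀ H s = refine hash c₀ G s from key _ le_rfl
    intro s
    induction s with
    | zero => exact fun _ => rfl
    | succ s ih =>
      intro hs
      have ihs := ih (by omega)
      funext v
      simp only [refine]
      rw [ihs, map_eq_of_factorsThrough (fun a b hab => refine_eq_of_le hinj c₀ G
        (by omega : s ≤ t) hab) (h v)]

theorem dinest_succ_eq {hash : K × Multiset K × Multiset K → K} (hinj : Function.Injective hash)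
    (c₀ : V → K) (t : ℕ) (G : Digraph V) :
    dinest hash c₀ (t + 1) G = {H | ∀ q, Loopless (pairEdges H.Adj (refineBoth hash c₀ G t) q) ∧
      SameDegrees (pairEdges H.Adj (refineBoth hash c₀ G t) q)
        (pairEdges G.Adj (refineBoth hash c₀ G t) q)} := by
  set c := refineBoth hash c₀ G t with hc
  ext H
  have hloop : (∀ v, ¬ H.Adj v v) ↔ ∀ q, Loopless (pairEdges H.Adj c q) :=
    ⟨fun h q v hv => h v (mem_pairEdges.1 hv).1,
      fun h v hv => h _ v ((adj_iff_mem_pairEdges c).1 hv)⟩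
  have hdeg : (∀ q, SameDegrees (pairEdges H.Adj c q) (pairEdges G.Adj c q)) ↔
      (∀ v, (Finset.univ.filter fun x => H.Adj x v).val.map c =
        (Finset.univ.filter fun x => G.Adj x v).val.map c) ∧
      ∀ v, (Finset.univ.filter fun x => H.Adj v x).val.map c =
        (Finset.univ.filter fun x => G.Adj v x).val.map c := by
    refine Iff.trans ?_ (and_congr map_inNeighbours_eq_iff map_neighbours_eq_iff).symm
    simp only [sameDegrees_iff, forall_and]
    exact and_comm
  rw [Set.mem_ofPred_eq, forall_and, hdeg, dinest, Set.mem_ofPred_eq, hloop]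
  refine and_congr_right fun _ => ⟨fun h => ?_, fun h => ?_⟩
  · have h1 (u : V) := Prod.mk.inj (hinj (congrFun h u))
    have h2 : refineBoth hash c₀ H t = c := funext fun u => (h1 u).1
    have h3 (v : V) := Prod.mk.inj (h1 v).2
    rw [h2] at h3
    exact ⟨fun v => (h3 v).1, fun v => (h3 v).2⟩
  · suffices key : ∀ s ≤ t + 1, refineBoth hash c₀ H s = refineBoth hash c₀ G s from key _ le_rfl
    intro s
    induction s with
    | zero => exact fun _ => rfl
    | succ s ih =>
      intro hs
      have ihs := ih (by omega)
      have hfac : Function.FactorsThrough (refineBoth hash c₀ G s) c := fun a b hab =>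
        refineBoth_eq_of_le hinj c₀ G (by omega : s ≤ t) hab
      funext v
      simp only [refineBoth]
      rw [ihs, map_eq_of_factorsThrough hfac (h.1 v), map_eq_of_factorsThrough hfac (h.2 v)]

end Refinement

/-! ### The block chain of directed graphs -/

section DirectedChain

variable {V K : Type*} [Fintype V] {c : V → K} {p : K × K}

theorem pairEdges_edit {G : Digraph V} {R A : Finset (V × V)} (hR : ∀ e ∈ R, (c e.1, c e.2) = p)
    (hA : ∀ e ∈ A, (c e.1, c e.2) = p) :
    pairEdges (edit G R A).Adj c p = replaceEdges (pairEdges G.Adj c p) R A ∧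
      ∀ q ≠ p, pairEdges (edit G R A).Adj c q = pairEdges G.Adj c q := by
  constructor
  · ext e
    have := hA e
    simp only [mem_pairEdges, mem_replaceEdges, edit, Finset.mem_coe]
    tauto
  · intro q hq
    ext e
    have h1 : (c e.1, c e.2) = q → e ∉ R := fun h h' => hq (h.symm.trans (hR e h'))
    have h2 : (c e.1, c e.2) = q → e ∉ A := fun h h' => hq (h.symm.trans (hA e h'))
    simp only [mem_pairEdges, edit, Finset.mem_coe]
    tauto

theorem digraph_eq_of_pairEdges {G H : Digraph V}
    (h : ∀ q, pairEdges G.Adj c q = pairEdges H.Adj c q) : G = H := by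
  ext u v
  rw [adj_iff_mem_pairEdges (adj := G.Adj) c, adj_iff_mem_pairEdges (adj := H.Adj) c, h]

theorem loopless_pairEdges {adj : V → V → Prop} (h : ∀ v, ¬ adj v v) (q : K × K) :
    Loopless (pairEdges adj c q) := fun v hv => h v (mem_pairEdges.1 hv).1

/-- The pairs `xy, zw` can be switched in the edge set `E`. -/
def Switchable {V : Type*} (E : Finset (V × V)) (x y z w : V) : Prop :=
  (x ≠ y ∧ x ≠ z ∧ x ≠ w ∧ y ≠ z ∧ y ≠ w ∧ z ≠ w) ∧
    ((x, y) ∈ E ∧ (z, w) ∈ E ∧ (x, w) ∉ E ∧ (z, y) ∉ E)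

theorem diswitch_of_switchable {G : Digraph V} {x y z w : V}
    (h : Switchable (pairEdges G.Adj c p) x y z w) :
    pairEdges (diswitch c p (x, y) (z, w) G).Adj c p =
        replaceEdges (pairEdges G.Adj c p) {(x, y), (z, w)} {(x, w), (z, y)} ∧
      ∀ q ≠ p, pairEdges (diswitch c p (x, y) (z, w) G).Adj c q = pairEdges G.Adj c q := by
  obtain ⟨hd, h1, h2, h3, h4⟩ := h
  have he : diswitch c p (x, y) (z, w) G =
      edit G ({(x, y), (z, w)} : Finset (V × V)) ({(x, w), (z, y)} : Finset (V × V)) := by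
    rw [diswitch, if_pos ⟨card_eq_four_of_distinct hd, h3, h4⟩]
    simp
  rw [he]
  have h1' := (mem_pairEdges.1 h1).2
  have h2' := (mem_pairEdges.1 h2).2
  simp only [Prod.ext_iff] at h1' h2'
  refine pairEdges_edit ?_ ?_ <;> rintro ⟨a, b⟩ hab <;> simp [Prod.ext_iff] at hab ⊢ <;> grind

theorem diswitch_eq_or (c : V → K) (p : K × K) {G : Digraph V} {e₁ e₂ : V × V}
    (h1 : e₁ ∈ pairEdges G.Adj c p) (h2 : e₂ ∈ pairEdges G.Adj c p) :
    diswitch c p e₁ e₂ G = G ∨ Switchable (pairEdges G.Adj c p) e₁.1 e₁.2 e₂.1 e₂.2 := by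
  by_cases h : ({e₁.1, e₁.2, e₂.1, e₂.2} : Finset V).card = 4 ∧
      (e₁.1, e₂.2) ∉ pairEdges G.Adj c p ∧ (e₂.1, e₁.2) ∉ pairEdges G.Adj c p
  · exact Or.inr ⟨distinct_of_card_eq_four h.1, h1, h2, h.2.1, h.2.2⟩
  · exact Or.inl (if_neg h)

theorem Switchable.replaceEdges {V : Type*} {E : Finset (V × V)} {x y z w : V}
    (h : Switchable E x y z w) :
    Switchable (replaceEdges E {(x, y), (z, w)} {(x, w), (z, y)}) x w z y ∧
      NeSt.replaceEdges (NeSt.replaceEdges E {(x, y), (z, w)} {(x, w), (z, y)})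
        {(x, w), (z, y)} {(x, y), (z, w)} = E := by
  obtain ⟨hd, h1, h2, h3, h4⟩ := h
  refine ⟨⟨by grind, ?_⟩, replaceEdges_replaceEdges (by grind) ?_⟩
  · simp only [mem_replaceEdges]
    grind
  · rw [Finset.disjoint_left]; grind

theorem diswitch_undo {G : Digraph V} {x y z w : V}
    (h : Switchable (pairEdges G.Adj c p) x y z w) :
    diswitch c p (x, w) (z, y) (diswitch c p (x, y) (z, w) G) = G := by
  obtain ⟨h1, h2⟩ := diswitch_of_switchable h
  obtain ⟨h3, h4⟩ := h.replaceEdges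
  rw [← h1] at h3 h4
  obtain ⟨h5, h6⟩ := diswitch_of_switchable h3
  refine digraph_eq_of_pairEdges (c := c) fun q => ?_
  by_cases hq : q = p
  · rw [hq, h5, h4]
  · rw [h6 q hq, h2 q hq]

theorem reverseTriangle_of_isDiTriangle {G : Digraph V} {x y z : V} (h : IsDiTriangle G c p x y z) :
    pairEdges (reverseTriangle c p x y z G).Adj c p =
        replaceEdges (pairEdges G.Adj c p) {(x, y), (y, z), (z, x)} {(y, x), (z, y), (x, z)} ∧
      ∀ q ≠ p, pairEdges (reverseTriangle c p x y z G).Adj c q = pairEdges G.Adj c q := by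
  have he : reverseTriangle c p x y z G = edit G ({(x, y), (y, z), (z, x)} : Finset (V × V))
      ({(y, x), (z, y), (x, z)} : Finset (V × V)) := by
    rw [reverseTriangle, if_pos h]
    simp
  rw [he]
  have h1' := (mem_pairEdges.1 h.1.1).2
  have h2' := (mem_pairEdges.1 h.1.2.1).2
  have h3' := (mem_pairEdges.1 h.1.2.2).2
  simp only [Prod.ext_iff] at h1' h2' h3'
  -- The target of the first edge is the source of the second, so the triangle lies in one class and
  -- the reversed edges stay in the block.
  have hp : p.1 = p.2 := by rw [← h2'.1, h1'.2]
  refine pairEdges_edit ?_ ?_ <;> rintro ⟨a, b⟩ hab <;> simp [Prod.ext_iff] at hab ⊢ <;> grind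

theorem diReversal_of_isDiTriangle {G : Digraph V} {x y z : V} (h : IsDiTriangle G c p x y z) :
    DiReversal (pairEdges G.Adj c p) (pairEdges (reverseTriangle c p x y z G).Adj c p) :=
  ⟨x, y, z, h.1, h.2, (reverseTriangle_of_isDiTriangle h).1⟩

theorem IsDiTriangle.reverse {G : Digraph V} {x y z : V} (h : IsDiTriangle G c p x y z) :
    IsDiTriangle (reverseTriangle c p x y z G) c p y x z := by
  have hxy : x ≠ y := by rintro rfl; exact h.2.1 h.1.1
  have hyz : y ≠ z := by rintro rfl; exact h.2.2.1 h.1.2.1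
  have hzx : z ≠ x := by rintro rfl; exact h.2.2.2 h.1.2.2
  rw [IsDiTriangle, (reverseTriangle_of_isDiTriangle h).1]
  simp [mem_replaceEdges, hxy, hyz, hzx, hxy.symm, hyz.symm, hzx.symm]

theorem reverseTriangle_undo {G : Digraph V} {x y z : V} (h : IsDiTriangle G c p x y z) :
    reverseTriangle c p y x z (reverseTriangle c p x y z G) = G := by
  obtain ⟨h1, h2⟩ := reverseTriangle_of_isDiTriangle h
  obtain ⟨h5, h6⟩ := reverseTriangle_of_isDiTriangle h.reverse
  refine digraph_eq_of_pairEdges (c := c) fun q => ?_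
  by_cases hq : q = p
  · subst hq
    have e1 : ({(y, x), (x, z), (z, y)} : Finset (V × V)) = {(y, x), (z, y), (x, z)} := by grind
    have e2 : ({(x, y), (z, x), (y, z)} : Finset (V × V)) = {(x, y), (y, z), (z, x)} := by grind
    obtain ⟨⟨h7, h8, h9⟩, h10, h11, h12⟩ := h
    rw [h5, h1, e1, e2, replaceEdges_replaceEdges]
    · simp only [Finset.insert_subset_iff, Finset.singleton_subset_iff]
      exact ⟨h7, h8, h9⟩
    · simp only [Finset.disjoint_left, Finset.mem_insert, Finset.mem_singleton]
      rintro e (rfl | rfl | rfl) <;> assumption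
  · rw [h6 q hq, h2 q hq]

theorem reverseTriangle_self (G : Digraph V) (u : V) : reverseTriangle c p u u u G = G :=
  if_neg fun h => h.2.1 h.1.1

theorem diswitch_self (G : Digraph V) (e : V × V) : diswitch c p e e G = G :=
  if_neg fun h => (distinct_of_card_eq_four h.1).2.1 rfl

/-- The loopless digraphs with the same degrees between the colour classes as `G`. -/
def diBlockSet (c : V → K) (G : Digraph V) : Set (Digraph V) :=
  {H | ∀ q, Loopless (pairEdges H.Adj c q) ∧
    SameDegrees (pairEdges H.Adj c q) (pairEdges G.Adj c q)}

theorem mem_diBlockSet_of_diStep {G H H' : Digraph V} (hH : H ∈ diBlockSet c G)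
    (hp : DiStep (pairEdges H.Adj c p) (pairEdges H'.Adj c p))
    (hq : ∀ q ≠ p, pairEdges H'.Adj c q = pairEdges H.Adj c q) : H' ∈ diBlockSet c G := by
  intro q
  by_cases hqp : q = p
  · rw [hqp]
    exact ⟨hp.loopless (hH p).1, hp.sameDegrees.trans (hH p).2⟩
  · rw [hq q hqp]
    exact hH q

theorem diswitch_mem {G H : Digraph V} (hH : H ∈ diBlockSet c G) {e₁ e₂ : V × V}
    (h1 : e₁ ∈ pairEdges H.Adj c p) (h2 : e₂ ∈ pairEdges H.Adj c p) :
    diswitch c p e₁ e₂ H ∈ diBlockSet c G ∧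
      ∀ q ≠ p, pairEdges (diswitch c p e₁ e₂ H).Adj c q = pairEdges H.Adj c q := by
  rcases diswitch_eq_or c p h1 h2 with h | h
  · rw [h]
    exact ⟨hH, fun _ _ => rfl⟩
  · have h3 := diswitch_of_switchable h
    exact ⟨mem_diBlockSet_of_diStep hH (Or.inl ⟨_, _, _, _, h.1, h.2, h3.1⟩) h3.2, h3.2⟩

theorem reverseTriangle_mem {G H : Digraph V} (hH : H ∈ diBlockSet c G) (x y z : V) :
    reverseTriangle c p x y z H ∈ diBlockSet c G ∧
      ∀ q ≠ p, pairEdges (reverseTriangle c p x y z H).Adj c q = pairEdges H.Adj c q := by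
  by_cases h : IsDiTriangle H c p x y z
  · have h3 := reverseTriangle_of_isDiTriangle h
    exact ⟨mem_diBlockSet_of_diStep hH (Or.inr (diReversal_of_isDiTriangle h)) h3.2, h3.2⟩
  · rw [reverseTriangle, if_neg h]
    exact ⟨hH, fun _ _ => rfl⟩

theorem pairEdges_nonempty_of_mem {G H : Digraph V} (hH : H ∈ diBlockSet c G)
    (hp : (pairEdges G.Adj c p).Nonempty) : (pairEdges H.Adj c p).Nonempty := by
  rwa [← Finset.card_pos, (hH p).2.card_eq, Finset.card_pos]

theorem pairNodes_nonempty {adj : V → V → Prop} (hp : (pairEdges adj c p).Nonempty) :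
    (pairNodes c p).Nonempty := by
  obtain ⟨e, he⟩ := hp
  have := Prod.ext_iff.1 (mem_pairEdges.1 he).2
  exact ⟨e.1, by simp [pairNodes, this.1.symm]⟩

/-- The first half of a directed step. A composite of symmetric kernels need not be symmetric, so
the switch and the triangle halves are shown to be doubly stochastic separately. -/
noncomputable def switchKernel (c : V → K) (p : K × K) (G : Digraph V) : PMF (Digraph V) :=
  draw (pairEdges G.Adj c p) G fun e₁ =>
    draw (pairEdges G.Adj c p) G fun e₂ => PMF.pure (diswitch c p e₁ e₂ G)

noncomputable def triangleKernel (c : V → K) (p : K × K) (G : Digraph V) : PMF (Digraph V) :=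
  draw (pairNodes c p) G fun u₁ => draw (pairNodes c p) G fun u₂ => draw (pairNodes c p) G fun u₃ =>
    PMF.pure (reverseTriangle c p u₁ u₂ u₃ G)

theorem draw_congr {α β : Type*} {T : Finset β} (x : α) {k k' : β → PMF α}
    (h : ∀ t ∈ T, k t = k' t) : draw T x k = draw T x k' := by
  by_cases hT : T.Nonempty
  · ext y
    rw [draw_apply hT, draw_apply hT]
    exact congrArg _ (Finset.sum_congr rfl fun t ht => by rw [h t ht])
  · rw [draw, draw, dif_neg hT, dif_neg hT]

theorem distep_eq_switchKernel (h : p.1 ≠ p.2) (G : Digraph V) :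
    distep c p G = switchKernel c p G := by
  refine draw_congr G fun e₁ he₁ => draw_congr G fun e₂ _ => if_neg ?_
  obtain ⟨-, rfl⟩ := mem_pairEdges.1 he₁
  exact h

theorem distep_eq_bind (h : p.1 = p.2) {G : Digraph V} (hG : (pairEdges G.Adj c p).Nonempty) :
    distep c p G = (switchKernel c p G).bind (triangleKernel c p) := by
  rw [switchKernel, draw_bind hG]
  refine draw_congr G fun e₁ he₁ => ?_
  rw [draw_bind hG]
  refine draw_congr G fun e₂ _ => ?_
  have h1 : c e₁.1 = c e₁.2 := by
    obtain ⟨-, rfl⟩ := mem_pairEdges.1 he₁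
    exact h
  rw [if_pos h1, PMF.pure_bind]
  rfl

theorem switchKernel_ne_zero_iff {G H : Digraph V} (hG : (pairEdges G.Adj c p).Nonempty) :
    switchKernel c p G H ≠ 0 ↔ ∃ e₁ ∈ pairEdges G.Adj c p, ∃ e₂ ∈ pairEdges G.Adj c p,
      diswitch c p e₁ e₂ G = H := by
  simp only [switchKernel, draw_ne_zero_iff hG, pure_ne_zero_iff]

theorem triangleKernel_ne_zero_iff {G H : Digraph V} (hp : (pairNodes c p).Nonempty) :
    triangleKernel c p G H ≠ 0 ↔ ∃ x ∈ pairNodes c p, ∃ y ∈ pairNodes c p, ∃ z ∈ pairNodes c p,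
      reverseTriangle c p x y z G = H := by
  simp only [triangleKernel, draw_ne_zero_iff hp, pure_ne_zero_iff]

theorem doublyStochasticOn_switchKernel {G : Digraph V} (hp : (pairEdges G.Adj c p).Nonempty) :
    DoublyStochasticOn (diBlockSet c G) (switchKernel c p) := by
  refine DoublyStochasticOn.of_symm (fun H hH F hF => ?_) fun H hH F hF => ?_
  · obtain ⟨e₁, h1, e₂, h2, rfl⟩ :=
      (switchKernel_ne_zero_iff (pairEdges_nonempty_of_mem hH hp)).1 hF
    exact (diswitch_mem hH h1 h2).1
  · by_cases hHF : H = F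
    · rw [hHF]
    have hstep {A B : Digraph V} (hAB : A ≠ B) (e : (V × V) × (V × V))
        (h1 : e.1 ∈ pairEdges A.Adj c p) (h2 : e.2 ∈ pairEdges A.Adj c p)
        (h : diswitch c p e.1 e.2 A = B) : (e.1.1, e.2.2) ∈ pairEdges B.Adj c p ∧
          (e.2.1, e.1.2) ∈ pairEdges B.Adj c p ∧
          diswitch c p (e.1.1, e.2.2) (e.2.1, e.1.2) B = A := by
      rcases diswitch_eq_or c p h1 h2 with h3 | h3
      · exact (hAB (h3.symm.trans h)).elim
      · have h4 := h3.replaceEdges.1.2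
        rw [← (diswitch_of_switchable h3).1, h] at h4
        refine ⟨h4.1, h4.2.1, ?_⟩
        have h5 := diswitch_undo h3
        rwa [Prod.mk.eta, Prod.mk.eta, h] at h5
    -- The pair xy, zw is undone by xw, zy; this assignment is an involution.
    refine draw_pair_symm (T := fun A : Digraph V => pairEdges A.Adj c p)
      (f := fun e₁ e₂ A => diswitch c p e₁ e₂ A)
      (σ := fun e => ((e.1.1, e.2.2), (e.2.1, e.1.2))) ?_ (pairEdges_nonempty_of_mem hH hp)
      (((hH p).2.trans (hF p).2.symm).card_eq) (hstep hHF) (hstep (Ne.symm hHF))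
    rintro ⟨⟨a, b⟩, a', b'⟩ ⟨⟨d, e⟩, d', e'⟩ h
    simp only [Prod.mk.injEq] at h ⊢
    tauto

theorem doublyStochasticOn_triangleKernel {G : Digraph V} (hp : (pairEdges G.Adj c p).Nonempty) :
    DoublyStochasticOn (diBlockSet c G) (triangleKernel c p) := by
  have hN := pairNodes_nonempty hp
  refine DoublyStochasticOn.of_symm (fun H hH F hF => ?_) fun H hH F hF => ?_
  · obtain ⟨x, -, y, -, z, -, rfl⟩ := (triangleKernel_ne_zero_iff hN).1 hF
    exact (reverseTriangle_mem hH x y z).1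
  · by_cases hHF : H = F
    · rw [hHF]
    have hstep {A B : Digraph V} (hAB : A ≠ B) (x y z : V)
        (h : reverseTriangle c p x y z A = B) : reverseTriangle c p y x z B = A := by
      by_cases h1 : IsDiTriangle A c p x y z
      · rw [← h, reverseTriangle_undo h1]
      · rw [reverseTriangle, if_neg h1] at h
        exact (hAB h).elim
    exact draw_triple_symm hN (f := fun x y z A => reverseTriangle c p x y z A) (hstep hHF)
      (hstep (Ne.symm hHF))

theorem doublyStochasticOn_distep {G : Digraph V} (hp : (pairEdges G.Adj c p).Nonempty) :
    DoublyStochasticOn (diBlockSet c G) (distep c p) := by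
  by_cases h : p.1 = p.2
  · exact ((doublyStochasticOn_switchKernel hp).bind (doublyStochasticOn_triangleKernel hp)).congr
      fun H hH => (distep_eq_bind h (pairEdges_nonempty_of_mem hH hp)).symm
  · exact (doublyStochasticOn_switchKernel hp).congr fun H _ => (distep_eq_switchKernel h H).symm

theorem pairEdges_eq_of_distep {G H F : Digraph V} (hp : (pairEdges G.Adj c p).Nonempty)
    (hH : H ∈ diBlockSet c G) (h : distep c p H F ≠ 0) {q : K × K} (hq : q ≠ p) :
    pairEdges F.Adj c q = pairEdges H.Adj c q := by
  have hE := pairEdges_nonempty_of_mem hH hp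
  by_cases hpp : p.1 = p.2
  · rw [distep_eq_bind hpp hE] at h
    obtain ⟨H', h1, h2⟩ := (PMF.mem_support_bind_iff _ _ _).1 ((PMF.mem_support_iff _ _).2 h)
    obtain ⟨e₁, he₁, e₂, he₂, rfl⟩ := (switchKernel_ne_zero_iff hE).1 h1
    obtain ⟨x, -, y, -, z, -, rfl⟩ := (triangleKernel_ne_zero_iff (pairNodes_nonempty hp)).1 h2
    have h3 := diswitch_mem hH he₁ he₂
    rw [(reverseTriangle_mem h3.1 x y z).2 q hq, h3.2 q hq]
  · rw [distep_eq_switchKernel hpp] at h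
    obtain ⟨e₁, he₁, e₂, he₂, rfl⟩ := (switchKernel_ne_zero_iff hE).1 h
    exact (diswitch_mem hH he₁ he₂).2 q hq

/-- The triangle half may idle: one node drawn three times is never a triangle. -/
theorem distep_diswitch_ne_zero {H : Digraph V} {e₁ e₂ : V × V}
    (h1 : e₁ ∈ pairEdges H.Adj c p) (h2 : e₂ ∈ pairEdges H.Adj c p) :
    distep c p H (diswitch c p e₁ e₂ H) ≠ 0 := by
  have hE : (pairEdges H.Adj c p).Nonempty := ⟨e₁, h1⟩
  have h3 := (switchKernel_ne_zero_iff hE).2 ⟨e₁, h1, e₂, h2, rfl⟩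
  by_cases hpp : p.1 = p.2
  · rw [distep_eq_bind hpp hE]
    obtain ⟨u, hu⟩ := pairNodes_nonempty hE
    exact (PMF.mem_support_iff _ _).1 ((PMF.mem_support_bind_iff _ _ _).2 ⟨_, h3,
      (triangleKernel_ne_zero_iff ⟨u, hu⟩).2 ⟨u, hu, u, hu, u, hu, reverseTriangle_self _ u⟩⟩)
  · rwa [distep_eq_switchKernel hpp]

theorem distep_self_ne_zero {H : Digraph V} (hE : (pairEdges H.Adj c p).Nonempty) :
    distep c p H H ≠ 0 := by
  obtain ⟨e, he⟩ := hE
  have := distep_diswitch_ne_zero he he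
  rwa [diswitch_self] at this

/-- The switch half may idle: the same edge may be drawn twice. -/
theorem distep_reverseTriangle_ne_zero {H : Digraph V} {x y z : V} (h : IsDiTriangle H c p x y z) :
    distep c p H (reverseTriangle c p x y z H) ≠ 0 := by
  have hE : (pairEdges H.Adj c p).Nonempty := ⟨_, h.1.1⟩
  have h1 := Prod.ext_iff.1 (mem_pairEdges.1 h.1.1).2
  have h2 := Prod.ext_iff.1 (mem_pairEdges.1 h.1.2.1).2
  have h3 := Prod.ext_iff.1 (mem_pairEdges.1 h.1.2.2).2
  have hpp : p.1 = p.2 := by rw [← h2.1, ← h1.2]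
  have hN {u : V} (hu : c u = p.1) : u ∈ pairNodes c p := by simp [pairNodes, hu]
  rw [distep_eq_bind hpp hE]
  exact (PMF.mem_support_iff _ _).1 ((PMF.mem_support_bind_iff _ _ _).2 ⟨H,
    (switchKernel_ne_zero_iff hE).2 ⟨_, h.1.1, _, h.1.1, diswitch_self H _⟩,
    (triangleKernel_ne_zero_iff (pairNodes_nonempty hE)).2
      ⟨x, hN h1.1, y, hN h2.1, z, hN h3.1, rfl⟩⟩)

theorem exists_distep_of_diStep {H : Digraph V} {E' : Finset (V × V)}
    (h : DiStep (pairEdges H.Adj c p) E') :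
    ∃ F, distep c p H F ≠ 0 ∧ pairEdges F.Adj c p = E' := by
  rcases h with ⟨x, y, z, w, hd, h, rfl⟩ | ⟨x, y, z, h1, h2, rfl⟩
  · exact ⟨_, distep_diswitch_ne_zero h.1 h.2.1, (diswitch_of_switchable ⟨hd, h⟩).1⟩
  · have h3 : IsDiTriangle H c p x y z := ⟨h1, h2⟩
    exact ⟨_, distep_reverseTriangle_ne_zero h3, (reverseTriangle_of_isDiTriangle h3).1⟩

theorem mem_iff_pairEdges_nonempty {G : Digraph V} {L : List (K × K)} (hL : IsDiPairList G c L)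
    (q : K × K) : q ∈ L ↔ (pairEdges G.Adj c q).Nonempty := by
  rw [hL.2 q]
  constructor
  · rintro ⟨u, v, huv, rfl⟩
    exact ⟨(u, v), by simpa using huv⟩
  · rintro ⟨e, he⟩
    exact ⟨e.1, e.2, (mem_pairEdges.1 he).1, (mem_pairEdges.1 he).2.symm⟩

theorem blockChain_distep (G : Digraph V) {L : List (K × K)} (hL : IsDiPairList G c L) :
    BlockChain (diBlockSet c G) L (distep c) (fun p H => (pairEdges H.Adj c p).card)
      (fun p H => pairEdges H.Adj c p) := by
  have hmem := mem_iff_pairEdges_nonempty hL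
  have hext : ∀ x ∈ diBlockSet c G, ∀ y ∈ diBlockSet c G,
      (∀ q ∈ L, pairEdges x.Adj c q = pairEdges y.Adj c q) → x = y := by
    refine fun H hH F hF h => digraph_eq_of_pairEdges (c := c) fun q => ?_
    by_cases hq : q ∈ L
    · exact h q hq
    · rw [hmem, Finset.not_nonempty_iff_eq_empty] at hq
      -- A block outside L is empty in G, hence in every graph with the same degrees.
      have h0 : ∀ H ∈ diBlockSet c G, pairEdges H.Adj c q = ∅ := fun H hH => by
        rw [← Finset.card_eq_zero, (hH q).2.card_eq, hq, Finset.card_empty]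
      rw [h0 H hH, h0 F hF]
  refine ⟨hL.1, fun p hp => doublyStochasticOn_distep ((hmem p).1 hp),
    fun p hp H hH => distep_self_ne_zero (pairEdges_nonempty_of_mem hH ((hmem p).1 hp)),
    fun p hp H hH F hF q _ hq => pairEdges_eq_of_distep ((hmem p).1 hp) hH hF hq,
    fun p _ H hH F hF => ((hH p).2.trans (hF p).2.symm).card_eq,
    fun p hp H hH => Finset.card_pos.2 (pairEdges_nonempty_of_mem hH ((hmem p).1 hp)),
    fun p hp H hH F hF hHF => ?_, hext, fun p _ H hH F hF => ?_⟩
  · have hp' := (hmem p).1 hp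
    have hreach := reflTransGen_diStep (hH p).1 (hF p).1 ((hH p).2.trans (hF p).2.symm)
    -- The path of edge sets of block p is lifted with all other blocks frozen; its end F' then
    -- agrees with F on every listed block.
    obtain ⟨F', ⟨hF', hF'q⟩, hreach', hF'p⟩ := exists_reflTransGen_lift
      (S := {A | A ∈ diBlockSet c G ∧ ∀ q ≠ p, pairEdges A.Adj c q = pairEdges H.Adj c q})
      (R := fun a b => distep c p a b ≠ 0) (f := fun A : Digraph V => pairEdges A.Adj c p)
      (fun A hA E' hE' => by
        obtain ⟨B, hB, hBE⟩ := exists_distep_of_diStep hE'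
        exact ⟨B, ⟨(doublyStochasticOn_distep hp').mem_of_ne_zero A hA.1 B hB, fun q hq =>
          (pairEdges_eq_of_distep hp' hA.1 hB hq).trans (hA.2 q hq)⟩, hB, hBE⟩)
      ⟨hH, fun _ _ => rfl⟩ hreach
    have : F' = F := hext F' hF' F hF fun q hq => by
      by_cases hqp : q = p
      · rw [hqp, hF'p]
      · rw [hF'q q hqp, hHF q hq hqp]
    rwa [this] at hreach'
  -- Z is F on block p and H elsewhere; membership is a condition on each block separately.
  · let Z : Digraph V := ⟨fun u v => if (c u, c v) = p then F.Adj u v else H.Adj u v⟩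
    have hZp : pairEdges Z.Adj c p = pairEdges F.Adj c p := by
      ext e
      by_cases he : (c e.1, c e.2) = p <;> simp [Z, he]
    have hZq : ∀ q ≠ p, pairEdges Z.Adj c q = pairEdges H.Adj c q := fun q hq => by
      ext e
      by_cases he : (c e.1, c e.2) = q
      · have : (c e.1, c e.2) ≠ p := he ▸ hq
        simp [Z, this]
      · simp [he]
    refine ⟨Z, fun q => ?_, hZp, fun q _ hq => hZq q hq⟩
    by_cases hq : q = p
    · rw [hq, hZp]
      exact hF p
    · rw [hZq q hq]
      exact hH q

theorem self_mem_diBlockSet {G : Digraph V} (hG : ∀ v, ¬ G.Adj v v) (c : V → K) :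
    G ∈ diBlockSet c G := fun q => ⟨loopless_pairEdges hG q, .refl _⟩

end DirectedChain

/-! ### The block chain of undirected graphs -/

section UndirectedChain

theorem SameDegrees.image_swap {V : Type*} {E F : Finset (V × V)} (h : SameDegrees E F) :
    SameDegrees (E.image Prod.swap) (F.image Prod.swap) := by
  have hval (E : Finset (V × V)) : (E.image Prod.swap).val = E.val.map Prod.swap :=
    Finset.image_val_of_injOn Prod.swap_injective.injOn
  simp only [SameDegrees, hval, Multiset.map_map]
  exact ⟨h.2, h.1⟩

variable {V K : Type*} [Fintype V] {c : V → K} {p : K × K}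

/-- The blocks q and `q.swap` hold the same edges in opposite orientations, which is why listing one
of them suffices. -/
theorem pairEdges_swap (G : SimpleGraph V) (c : V → K) (q : K × K) :
    pairEdges G.Adj c q.swap = (pairEdges G.Adj c q).image Prod.swap := by
  ext ⟨u, v⟩
  simp only [mem_pairEdges, Finset.mem_image, Prod.exists, Prod.ext_iff,
    Prod.fst_swap, Prod.snd_swap]
  constructor
  · rintro ⟨h, h1, h2⟩
    exact ⟨v, u, ⟨h.symm, h2, h1⟩, rfl, rfl⟩
  · rintro ⟨v, u, ⟨h, h2, h1⟩, rfl, rfl⟩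
    exact ⟨h.symm, h1, h2⟩

theorem switch_adj_iff {G : SimpleGraph V} {x y z w : V}
    (h : Switchable (pairEdges G.Adj c p) x y z w) (u v : V) :
    (switch c p (x, y) (z, w) G).Adj u v ↔
      (G.Adj u v ∧ (u, v) ∉ ({(x, y), (y, x), (z, w), (w, z)} : Finset (V × V))) ∨
        (u, v) ∈ ({(x, w), (w, x), (z, y), (y, z)} : Finset (V × V)) := by
  obtain ⟨hd, h1, h2, h3, h4⟩ := h
  rw [switch, if_pos ⟨card_eq_four_of_distinct hd, h3, h4⟩]
  simp only [SimpleGraph.sup_adj, SimpleGraph.deleteEdges_adj, SimpleGraph.fromEdgeSet_adj,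
    Set.mem_insert_iff, Set.mem_singleton_iff, Sym2.eq_iff, Finset.mem_insert,
    Finset.mem_singleton, Prod.mk.injEq]
  grind

theorem switch_eq_or (c : V → K) (p : K × K) {G : SimpleGraph V} {e₁ e₂ : V × V}
    (h1 : e₁ ∈ pairEdges G.Adj c p) (h2 : e₂ ∈ pairEdges G.Adj c p) :
    switch c p e₁ e₂ G = G ∨ Switchable (pairEdges G.Adj c p) e₁.1 e₁.2 e₂.1 e₂.2 := by
  by_cases h : ({e₁.1, e₁.2, e₂.1, e₂.2} : Finset V).card = 4 ∧
      (e₁.1, e₂.2) ∉ pairEdges G.Adj c p ∧ (e₂.1, e₁.2) ∉ pairEdges G.Adj c p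
  · exact Or.inr ⟨distinct_of_card_eq_four h.1, h1, h2, h.2.1, h.2.2⟩
  · exact Or.inl (if_neg h)

theorem switch_self (G : SimpleGraph V) (e : V × V) : switch c p e e G = G :=
  if_neg fun h => (distinct_of_card_eq_four h.1).2.1 rfl

theorem Switchable.colours {G : SimpleGraph V} {x y z w : V}
    (h : Switchable (pairEdges G.Adj c p) x y z w) :
    (c x = p.1 ∧ c y = p.2) ∧ (c z = p.1 ∧ c w = p.2) :=
  ⟨by simpa [Prod.ext_iff] using (mem_pairEdges.1 h.2.1).2,
    by simpa [Prod.ext_iff] using (mem_pairEdges.1 h.2.2.1).2⟩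

theorem Switchable.not_adj {G : SimpleGraph V} {x y z w : V}
    (h : Switchable (pairEdges G.Adj c p) x y z w) :
    G.Adj x y ∧ G.Adj z w ∧ ¬ G.Adj x w ∧ ¬ G.Adj z y := by
  have hc := h.colours
  refine ⟨(mem_pairEdges.1 h.2.1).1, (mem_pairEdges.1 h.2.2.1).1, fun h' => h.2.2.2.1 ?_,
    fun h' => h.2.2.2.2 ?_⟩
  · simp [h', hc]
  · simp [h', hc]

theorem Switchable.switch {G : SimpleGraph V} {x y z w : V}
    (h : Switchable (pairEdges G.Adj c p) x y z w) :
    Switchable (pairEdges (switch c p (x, y) (z, w) G).Adj c p) x w z y := by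
  have hc := h.colours
  have hd := h.1
  refine ⟨by grind, ?_⟩
  simp only [mem_pairEdges, switch_adj_iff h, Finset.mem_insert, Finset.mem_singleton,
    Prod.ext_iff, hc]
  grind

theorem switch_undo {G : SimpleGraph V} {x y z w : V}
    (h : Switchable (pairEdges G.Adj c p) x y z w) :
    switch c p (x, w) (z, y) (switch c p (x, y) (z, w) G) = G := by
  obtain ⟨h1, h2, h3, h4⟩ := h.not_adj
  have h1' := h1.symm
  have h2' := h2.symm
  have h3' : ¬ G.Adj w x := fun h => h3 h.symm
  have h4' : ¬ G.Adj y z := fun h => h4 h.symm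
  ext u v
  rw [switch_adj_iff h.switch, switch_adj_iff h]
  simp only [Finset.mem_insert, Finset.mem_singleton, Prod.mk.injEq]
  grind

/-- Inside a class both orientations of an edge lie in the block, so four ordered pairs are traded;
between different classes it is only two. -/
theorem pairEdges_switch_of_eq {G : SimpleGraph V} {x y z w : V} (hp : p.1 = p.2)
    (h : Switchable (pairEdges G.Adj c p) x y z w) :
    pairEdges (switch c p (x, y) (z, w) G).Adj c p = replaceEdges (pairEdges G.Adj c p)
      {(x, y), (y, x), (z, w), (w, z)} {(x, w), (w, x), (z, y), (y, z)} := by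
  have hc := h.colours
  ext ⟨u, v⟩
  simp only [mem_pairEdges, mem_replaceEdges, switch_adj_iff h, Finset.mem_insert,
    Finset.mem_singleton, Prod.ext_iff]
  grind

theorem pairEdges_switch_of_ne {G : SimpleGraph V} {x y z w : V} (hp : p.1 ≠ p.2)
    (h : Switchable (pairEdges G.Adj c p) x y z w) :
    pairEdges (switch c p (x, y) (z, w) G).Adj c p = replaceEdges (pairEdges G.Adj c p)
      {(x, y), (z, w)} {(x, w), (z, y)} := by
  have hc := h.colours
  ext ⟨u, v⟩
  simp only [mem_pairEdges, mem_replaceEdges, switch_adj_iff h, Finset.mem_insert,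
    Finset.mem_singleton, Prod.ext_iff]
  grind

theorem pairEdges_switch_of_ne_pair {G : SimpleGraph V} {x y z w : V}
    (h : Switchable (pairEdges G.Adj c p) x y z w) {q : K × K} (hq : q ≠ p) (hq' : q ≠ p.swap) :
    pairEdges (switch c p (x, y) (z, w) G).Adj c q = pairEdges G.Adj c q := by
  have hc := h.colours
  rw [Ne, Prod.ext_iff] at hq hq'
  simp only [Prod.fst_swap, Prod.snd_swap] at hq'
  ext ⟨u, v⟩
  simp only [mem_pairEdges, switch_adj_iff h, Finset.mem_insert, Finset.mem_singleton,
    Prod.ext_iff]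
  grind

/-- The graphs with the same degrees between the colour classes as `G`. -/
def blockSet (c : V → K) (G : SimpleGraph V) : Set (SimpleGraph V) :=
  {H | ∀ q, SameDegrees (pairEdges H.Adj c q) (pairEdges G.Adj c q)}

theorem symmEdges_pairEdges (G : SimpleGraph V) (c : V → K) (hp : p.1 = p.2) :
    SymmEdges (pairEdges G.Adj c p) := by
  intro x y h
  simp only [mem_pairEdges, Prod.ext_iff] at h ⊢
  exact ⟨h.1.symm, by rw [h.2.2, hp], by rw [h.2.1, hp]⟩

theorem mem_blockSet_of_sameDegrees {G H H' : SimpleGraph V} (hH : H ∈ blockSet c G)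
    (hp : SameDegrees (pairEdges H'.Adj c p) (pairEdges H.Adj c p))
    (hq : ∀ q ≠ p, q ≠ p.swap → pairEdges H'.Adj c q = pairEdges H.Adj c q) :
    H' ∈ blockSet c G := by
  intro q
  refine SameDegrees.trans ?_ (hH q)
  by_cases hqp : q = p
  · rw [hqp]
    exact hp
  by_cases hqp' : q = p.swap
  · rw [hqp', pairEdges_swap H', pairEdges_swap H]
    exact hp.image_swap
  · rw [hq q hqp hqp']
    exact .refl _

theorem switch_mem {G H : SimpleGraph V} (hH : H ∈ blockSet c G) {e₁ e₂ : V × V}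
    (h1 : e₁ ∈ pairEdges H.Adj c p) (h2 : e₂ ∈ pairEdges H.Adj c p) :
    switch c p e₁ e₂ H ∈ blockSet c G ∧ ∀ q ≠ p, q ≠ p.swap →
      pairEdges (switch c p e₁ e₂ H).Adj c q = pairEdges H.Adj c q := by
  rcases switch_eq_or c p h1 h2 with h | h
  · rw [h]
    exact ⟨hH, fun _ _ _ => rfl⟩
  · refine ⟨mem_blockSet_of_sameDegrees (p := p) hH ?_ fun q => pairEdges_switch_of_ne_pair h,
      fun q => pairEdges_switch_of_ne_pair h⟩
    by_cases hp : p.1 = p.2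
    · exact UnSwitch.sameDegrees (symmEdges_pairEdges H c hp)
        ⟨_, _, _, _, h.1, h.2, pairEdges_switch_of_eq hp h⟩
    · exact DiSwitch.sameDegrees ⟨_, _, _, _, h.1, h.2, pairEdges_switch_of_ne hp h⟩

theorem pairEdges_nonempty_of_mem_blockSet {G H : SimpleGraph V} (hH : H ∈ blockSet c G)
    (hp : (pairEdges G.Adj c p).Nonempty) : (pairEdges H.Adj c p).Nonempty := by
  rwa [← Finset.card_pos, (hH p).card_eq, Finset.card_pos]

theorem step_ne_zero_iff {G H : SimpleGraph V} (hG : (pairEdges G.Adj c p).Nonempty) :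
    step c p G H ≠ 0 ↔ ∃ e₁ ∈ pairEdges G.Adj c p, ∃ e₂ ∈ pairEdges G.Adj c p,
      switch c p e₁ e₂ G = H := by
  simp only [step, draw_ne_zero_iff hG, pure_ne_zero_iff]

theorem doublyStochasticOn_step {G : SimpleGraph V} (hp : (pairEdges G.Adj c p).Nonempty) :
    DoublyStochasticOn (blockSet c G) (step c p) := by
  refine DoublyStochasticOn.of_symm (fun H hH F hF => ?_) fun H hH F hF => ?_
  · obtain ⟨e₁, h1, e₂, h2, rfl⟩ :=
      (step_ne_zero_iff (pairEdges_nonempty_of_mem_blockSet hH hp)).1 hF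
    exact (switch_mem hH h1 h2).1
  · by_cases hHF : H = F
    · rw [hHF]
    have hstep {A B : SimpleGraph V} (hAB : A ≠ B) (e : (V × V) × (V × V))
        (h1 : e.1 ∈ pairEdges A.Adj c p) (h2 : e.2 ∈ pairEdges A.Adj c p)
        (h : switch c p e.1 e.2 A = B) : (e.1.1, e.2.2) ∈ pairEdges B.Adj c p ∧
          (e.2.1, e.1.2) ∈ pairEdges B.Adj c p ∧
          switch c p (e.1.1, e.2.2) (e.2.1, e.1.2) B = A := by
      rcases switch_eq_or c p h1 h2 with h3 | h3
      · exact (hAB (h3.symm.trans h)).elim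
      · have h4 := h3.switch.2
        have h5 := switch_undo h3
        rw [Prod.mk.eta, Prod.mk.eta, h] at h4 h5
        exact ⟨h4.1, h4.2.1, h5⟩
    refine draw_pair_symm (T := fun A : SimpleGraph V => pairEdges A.Adj c p)
      (f := fun e₁ e₂ A => switch c p e₁ e₂ A)
      (σ := fun e => ((e.1.1, e.2.2), (e.2.1, e.1.2))) ?_
      (pairEdges_nonempty_of_mem_blockSet hH hp)
      (((hH p).trans (hF p).symm).card_eq) (hstep hHF) (hstep (Ne.symm hHF))
    rintro ⟨⟨a, b⟩, a', b'⟩ ⟨⟨d, e⟩, d', e'⟩ h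
    simp only [Prod.mk.injEq] at h ⊢
    tauto

theorem exists_step_of_blockMove {H : SimpleGraph V} {E' : Finset (V × V)}
    (h : if p.1 = p.2 then UnSwitch (pairEdges H.Adj c p) E' else
      DiStep (pairEdges H.Adj c p) E') :
    ∃ F, step c p H F ≠ 0 ∧ pairEdges F.Adj c p = E' := by
  have hsw {x y z w : V} (h : Switchable (pairEdges H.Adj c p) x y z w) :
      step c p H (switch c p (x, y) (z, w) H) ≠ 0 :=
    (step_ne_zero_iff ⟨_, h.2.1⟩).2 ⟨_, h.2.1, _, h.2.2.1, rfl⟩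
  by_cases hp : p.1 = p.2
  · rw [if_pos hp] at h
    obtain ⟨x, y, z, w, hd, h, rfl⟩ := h
    have h' : Switchable (pairEdges H.Adj c p) x y z w := ⟨hd, h⟩
    exact ⟨_, hsw h', pairEdges_switch_of_eq hp h'⟩
  · rw [if_neg hp] at h
    rcases h with ⟨x, y, z, w, hd, h, rfl⟩ | ⟨x, y, z, ⟨h1, h2, -⟩, -⟩
    · have h' : Switchable (pairEdges H.Adj c p) x y z w := ⟨hd, h⟩
      exact ⟨_, hsw h', pairEdges_switch_of_ne hp h'⟩
    -- Consecutive edges xy, yz in the block would force p.1 = p.2, so no reversal occurs here.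
    · rw [mem_pairEdges, Prod.ext_iff] at h1 h2
      exact (hp (h2.2.1.symm.trans h1.2.2)).elim

/-- Between different classes each edge has one orientation in the block, so the theorem on digraphs
applies; inside a class the symmetric version is needed. -/
theorem reflTransGen_blockMove {G H F : SimpleGraph V} (hH : H ∈ blockSet c G)
    (hF : F ∈ blockSet c G) :
    Relation.ReflTransGen (fun E E' => if p.1 = p.2 then UnSwitch E E' else DiStep E E')
      (pairEdges H.Adj c p) (pairEdges F.Adj c p) := by
  have hloop (A : SimpleGraph V) : Loopless (pairEdges A.Adj c p) :=
    loopless_pairEdges (fun v => A.loopless.irrefl v) p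
  have hd := (hH p).trans (hF p).symm
  by_cases hp : p.1 = p.2
  · simp only [if_pos hp]
    exact reflTransGen_unSwitch (hloop H) (hloop F) (symmEdges_pairEdges H c hp)
      (symmEdges_pairEdges F c hp) hd
  · simp only [if_neg hp]
    exact reflTransGen_diStep (hloop H) (hloop F) hd

theorem simpleGraph_eq_of_pairEdges {G H : SimpleGraph V}
    (h : ∀ q, pairEdges G.Adj c q = pairEdges H.Adj c q) : G = H := by
  ext u v
  rw [adj_iff_mem_pairEdges (adj := G.Adj) c, adj_iff_mem_pairEdges (adj := H.Adj) c, h]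

theorem sym2_mem_iff_pairEdges_nonempty {G : SimpleGraph V} {L : List (K × K)}
    (hL : IsPairList G c L) (q : K × K) :
    s(q.1, q.2) ∈ (L.map fun p => s(p.1, p.2)) ↔ (pairEdges G.Adj c q).Nonempty := by
  rw [hL.2]
  constructor
  · rintro ⟨u, v, huv, h⟩
    rcases Sym2.eq_iff.1 h with h | h
    · exact ⟨(u, v), by simp [huv, Prod.ext_iff, h]⟩
    · exact ⟨(v, u), by simp [huv.symm, Prod.ext_iff, h]⟩
  · rintro ⟨e, he⟩
    obtain ⟨hadj, rfl⟩ := mem_pairEdges.1 he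
    exact ⟨e.1, e.2, hadj, rfl⟩

theorem ne_swap_of_mem {L : List (K × K)} (hL : (L.map fun p => s(p.1, p.2)).Nodup)
    {q : K × K} (hp : p ∈ L) (hq : q ∈ L) (h : q ≠ p) : q ≠ p.swap := by
  rintro rfl
  exact h (List.inj_on_of_nodup_map hL hq hp Sym2.eq_swap)

theorem blockChain_step (G : SimpleGraph V) {L : List (K × K)} (hL : IsPairList G c L) :
    BlockChain (blockSet c G) L (step c) (fun p H => (pairEdges H.Adj c p).card)
      (fun p H => pairEdges H.Adj c p) := by
  have hne : ∀ p ∈ L, (pairEdges G.Adj c p).Nonempty := fun p hp =>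
    (sym2_mem_iff_pairEdges_nonempty hL p).1 (List.mem_map.2 ⟨p, hp, rfl⟩)
  have hext : ∀ x ∈ blockSet c G, ∀ y ∈ blockSet c G,
      (∀ q ∈ L, pairEdges x.Adj c q = pairEdges y.Adj c q) → x = y := by
    refine fun H hH F hF h => simpleGraph_eq_of_pairEdges (c := c) fun q => ?_
    by_cases hq : s(q.1, q.2) ∈ L.map fun p => s(p.1, p.2)
    · obtain ⟨p, hp, hpq⟩ := List.mem_map.1 hq
      rcases Sym2.eq_iff.1 hpq with h' | h'
      · exact Prod.ext_iff.2 h' ▸ h p hp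
      -- The list may name the block by its other orientation.
      · have : q = p.swap := Prod.ext h'.2.symm h'.1.symm
        rw [this, pairEdges_swap H, pairEdges_swap F, h p hp]
    · rw [sym2_mem_iff_pairEdges_nonempty hL, Finset.not_nonempty_iff_eq_empty] at hq
      have h0 : ∀ H ∈ blockSet c G, pairEdges H.Adj c q = ∅ := fun H hH => by
        rw [← Finset.card_eq_zero, (hH q).card_eq, hq, Finset.card_empty]
      rw [h0 H hH, h0 F hF]
  have hstep {p : K × K} (hp : p ∈ L) {H F : SimpleGraph V} (hH : H ∈ blockSet c G)
      (hF : step c p H F ≠ 0) : ∀ q ∈ L, q ≠ p → pairEdges F.Adj c q = pairEdges H.Adj c q := by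
    intro q hq hqp
    obtain ⟨e₁, h1, e₂, h2, rfl⟩ :=
      (step_ne_zero_iff (pairEdges_nonempty_of_mem_blockSet hH (hne p hp))).1 hF
    exact (switch_mem hH h1 h2).2 q hqp (ne_swap_of_mem hL.1 hp hq hqp)
  refine ⟨hL.1.of_map _, fun p hp => doublyStochasticOn_step (hne p hp), fun p hp H hH => ?_,
    fun p hp H hH F hF => hstep hp hH hF,
    fun p _ H hH F hF => ((hH p).trans (hF p).symm).card_eq,
    fun p hp H hH => Finset.card_pos.2 (pairEdges_nonempty_of_mem_blockSet hH (hne p hp)),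
    fun p hp H hH F hF hHF => ?_, hext, fun p hp H hH F hF => ?_⟩
  · obtain ⟨e, he⟩ := pairEdges_nonempty_of_mem_blockSet hH (hne p hp)
    exact (step_ne_zero_iff ⟨e, he⟩).2 ⟨e, he, e, he, switch_self H e⟩
  · obtain ⟨F', ⟨hF', hF'q⟩, hreach', hF'p⟩ := exists_reflTransGen_lift
      (S := {A | A ∈ blockSet c G ∧ ∀ q ∈ L, q ≠ p → pairEdges A.Adj c q = pairEdges H.Adj c q})
      (R := fun a b => step c p a b ≠ 0) (f := fun A : SimpleGraph V => pairEdges A.Adj c p)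
      (fun A hA E' hE' => by
        obtain ⟨B, hB, hBE⟩ := exists_step_of_blockMove hE'
        exact ⟨B, ⟨(doublyStochasticOn_step (hne p hp)).mem_of_ne_zero A hA.1 B hB,
          fun q hq hqp => (hstep hp hA.1 hB q hq hqp).trans (hA.2 q hq hqp)⟩, hB, hBE⟩)
      ⟨hH, fun _ _ _ => rfl⟩ (reflTransGen_blockMove hH hF)
    have : F' = F := hext F' hF' F hF fun q hq => by
      by_cases hqp : q = p
      · rw [hqp, hF'p]
      · rw [hF'q q hq hqp, hHF q hq hqp]
    rwa [this] at hreach'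
  -- Both orientations of the block are taken from F, so that adjacency is symmetric.
  · let Z : SimpleGraph V :=
      { Adj := fun u v => if (c u, c v) = p ∨ (c u, c v) = p.swap then F.Adj u v else H.Adj u v
        symm := by
          refine ⟨fun u v h => ?_⟩
          have : ((c v, c u) = p ∨ (c v, c u) = p.swap) ↔
              ((c u, c v) = p ∨ (c u, c v) = p.swap) := by
            simp only [Prod.ext_iff, Prod.fst_swap, Prod.snd_swap]
            tauto
          simp only [this]
          split_ifs at h ⊢
          · exact h.symm
          · exact h.symm
        loopless := ⟨fun v h => by split_ifs at h <;> exact h.ne rfl⟩ }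
    have hZp : pairEdges Z.Adj c p = pairEdges F.Adj c p := by
      ext e
      by_cases he : (c e.1, c e.2) = p <;> simp [Z, he]
    have hZq : ∀ q ≠ p, q ≠ p.swap → pairEdges Z.Adj c q = pairEdges H.Adj c q :=
      fun q hq hq' => by
        ext e
        by_cases he : (c e.1, c e.2) = q
        · have h1 : (c e.1, c e.2) ≠ p := he ▸ hq
          have h2 : (c e.1, c e.2) ≠ p.swap := he ▸ hq'
          simp [Z, h1, h2]
        · simp [he]
    refine ⟨Z, mem_blockSet_of_sameDegrees (p := p) hH ?_ hZq, hZp,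
      fun q hq hqp => hZq q hqp (ne_swap_of_mem hL.1 hp hq hqp)⟩
    rw [hZp]
    exact (hF p).trans (hH p).symm

end UndirectedChain

end NeSt

/-! ### The sampling theorem -/

theorem mainTheorem2 {V K : Type*} [Fintype V] (c₀ : V → K) (d : ℕ) (hd : 0 < d) :
    (∀ (hash : K × Multiset K → K), Function.Injective hash →
      ∀ (G : SimpleGraph V) (L : List (K × K)),
        NeSt.IsPairList G (NeSt.refine hash c₀ G (d - 1)) L →
        NeSt.SamplesUniformly (NeSt.nest hash c₀ d G)
          (NeSt.algorithmOne (NeSt.refine hash c₀ G (d - 1)) L) G ∧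
        ∀ sel : L ≠ [] → PMF {p // p ∈ L}, (∀ h p, sel h p ≠ 0) →
          NeSt.SamplesUniformly (NeSt.nest hash c₀ d G)
            (NeSt.algorithmTwo (NeSt.refine hash c₀ G (d - 1)) L sel) G) ∧
    (∀ (hash : K × Multiset K × Multiset K → K), Function.Injective hash →
      ∀ (G : Digraph V), (∀ v, ¬ G.Adj v v) → ∀ (L : List (K × K)),
        NeSt.IsDiPairList G (NeSt.refineBoth hash c₀ G (d - 1)) L →
        NeSt.SamplesUniformly (NeSt.dinest hash c₀ d G)
          (NeSt.diAlgorithmOne (NeSt.refineBoth hash c₀ G (d - 1)) L) G ∧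
        ∀ sel : L ≠ [] → PMF {p // p ∈ L}, (∀ h p, sel h p ≠ 0) →
          NeSt.SamplesUniformly (NeSt.dinest hash c₀ d G)
            (NeSt.diAlgorithmTwo (NeSt.refineBoth hash c₀ G (d - 1)) L sel) G) := by
  -- As d is positive, the subtraction d - 1 is not truncated and the blocks belong to the colouring
  -- of round t = d - 1.
  obtain ⟨t, rfl⟩ := Nat.exists_eq_succ_of_ne_zero hd.ne'
  rw [Nat.succ_eq_add_one, Nat.add_sub_cancel]
  constructor
  · intro hash hinj G L hL
    rw [NeSt.nest_succ_eq hinj]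
    have hchain := NeSt.blockChain_step G hL
    have hG : G ∈ NeSt.blockSet (NeSt.refine hash c₀ G t) G := fun q => .refl _
    exact ⟨hchain.samplesUniformly_visitAll hG,
      fun sel hsel => hchain.samplesUniformly_visitRandom sel hsel hG⟩
  · intro hash hinj G hG₀ L hL
    rw [NeSt.dinest_succ_eq hinj]
    have hchain := NeSt.blockChain_distep G hL
    have hG := NeSt.self_mem_diBlockSet hG₀ (NeSt.refineBoth hash c₀ G t)
    exact ⟨hchain.samplesUniformly_visitAll hG,
      fun sel hsel => hchain.samplesUniformly_visitRandom sel hsel hG⟩
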